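/- \textbf{Setting.} Fix a term algebra: data values, data operators with their interpretation on values, action labels, and a set of values regarded as true. \emph{Expressions} over a set $X$ of variables are values, variables, and operators applied to expressions; an expression used as a guard holds under a valuation if its value is true. \emph{Action terms} are $a(e_1,\dots,e_n)$ with $a$ a label and $e_i$ expressions; the \emph{signature} of such a term is $(a,n)$, and a \emph{sort} is a set of signatures (an action term belongs to a sort if its signature does). Action terms with inputs are $a(p_1,\dots,p_n)$ where each $p_i$ is an expression or an input variable $?x$, an input variable occurring only once in the term. Labels are free constructors: the formula $a(e_1,\dots,e_n)=a'(e'_1,\dots,e'_m)$ means $a=a'$, $n=m$ and $e_i=e'_i$ for all $i$. Predicates are taken modulo logical equivalence (as predicates on valuations). \textbf{pNets.} A \emph{pLTS} consists of a set $S$ of states, an initial state, a set $V$ of variables (some of which may have an initial value) and a set of transitions $s\xrightarrow{\langle\alpha,\,e_b,\,(x_j:=e_j)_{j}\rangle}s'$, where $\alpha$ is an action term with inputs whose non-input variables are in $V$, the guard $e_b$ and the expressions $e_j$ are over $V$ and the input variables of $\alpha$, and $x_j\in V$. A \emph{pNet} is a pLTS or a node $\langle P_i^{i\in I},\mathrm{Sort}_j^{j\in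 J},SV_k^{k\in K}\rangle$ with sub-pNets $P_i$, holes $j\in J$ of sorts $\mathrm{Sort}_j$, $I\cap J=\emptyset$, $I\cup J\neq\emptyset$, and synchronisation vectors $SV_k=\big((\alpha'_l)^{l\in I_k\uplus J_k}\to\alpha'\,[e]\big)$ with $I_k\subseteq I$, $J_k\subseteq J$, $\alpha'_i\in\mathrm{Sort}(P_i)$ for $i \in I_k$, $\alpha'_j\in\mathrm{Sort}_j$ for $j \in J_k$, where the variables of the global action $\alpha'$ and of the guard $e$ occur in the $\alpha'_l$. Here $\mathrm{Sort}(P)$ is the set of signatures of the actions of the transitions (for a pLTS) or of the global actions of the vectors (for a node). $\mathrm{Holes}(P)$ is the set of all holes of $P$, those of its sub-pNets included; all these holes are distinct. The variables of distinct leaves (pLTSs) are distinct, and $\mathrm{vars}(P)$ is their disjoint union. \emph{Filling} a hole of $P$ by a pNet $Q$ turns the hole into a sub-pNet $Q$ of the node to which the hole belongs, leaving the vectors unchanged. For $B\subseteq\mathrm{Holes}(P)$, $P[Q_j]_{j\in B}$ is obtained by filling simultaneously each hole $j\in B$ with $Q_j$. \textbf{Open automata.} An \emph{open transition} $\langle(\beta_j)^{j\in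 J'},\mathrm{Pred},\mathrm{Post}\rangle: s\xrightarrow{\alpha}s'$ over holes $J$ with sorts, states $\mathcal S$ and variables $V$ consists of states $s,s'$, action terms $\beta_j\in\mathrm{Sort}_j$ for $j$ in a set $J'\subseteq J$, an action term $\alpha$, a predicate $\mathrm{Pred}$ and a parallel assignment $\mathrm{Post}$ of expressions to some variables of $V$; all these terms may contain variables of $V$ and further, free, variables. An \emph{open automaton} $\langle J,\mathcal S,s_0,V,\mathcal T\rangle$ has a set $\mathcal T$ of open transitions closed under refinement: replacing free variables by expressions throughout and strengthening the predicate. The semantics of a pNet $P$ is the open automaton with holes $\mathrm{Holes}(P)$, states the tuples of states of the leaves of $P$, the tuple of the initial states as initial state, variables $\mathrm{vars}(P)$ with their initial values, and the least set of open transitions closed under refinement and the following rules. (1) A transition $s\xrightarrow{\langle\alpha,e_b,(x_j:=e_j)_j\rangle}s'$ of a pLTS gives $\langle\emptyset,e_b,(x_j\gets e_j)_j\rangle:s\xrightarrow{\alpha}s'$ (with input markers removed). (2) For a node and a vector $SV_k$ as above, open transitions of the $P_i$, $i\in I_k$, with hole actions $(\beta_h)^{h\in J_i}$, action $\alpha_i$,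 predicate $\mathrm{Pred}_i$ and assignment $\mathrm{Post}_i$, together with $\beta_j\in\mathrm{Sort}_j$ for $j\in J_k$ and $\alpha$, give the open transition with hole actions $(\beta_h)$ for $h \in\biguplus_{i\in I_k}J_i\uplus J_k$, action $\alpha$, predicate $\bigwedge_{i\in I_k}(\mathrm{Pred}_i\wedge\alpha_i=\alpha'_i)\wedge\bigwedge_{j\in J_k}\beta_j=\alpha'_j\wedge\alpha=\alpha'\wedge e$ and assignment $\biguplus_{i\in I_k}\mathrm{Post}_i$, in which the leaves of the $P_i$ with $i\in I_k$ move as in these transitions and the others do not move; the variables of the $\beta_j$ ($j\in J_k$), of $\alpha$ and of the vector are fresh. \textbf{FH-bisimulation.} Let $A_1,A_2$ be open automata with the same holes of the same sorts, and with disjoint sets of variables $V_1,V_2$ (after renaming). A relation $\mathcal R$ associates with all states $s$ of $A_1$ and $t$ of $A_2$ a predicate $\mathrm{Pred}_{s,t}$ over $V_1\uplus V_2$. It is an \emph{FH-bisimulation} if for all $s,t$ and every open transition $\langle(\beta_j)^{j\in J'},\mathrm{Pred}_{OT},\mathrm{Post}_{OT}\rangle:s\xrightarrow{\alpha}s'$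 of $A_1$ there is a family, indexed by a set $X$, of open transitions $\langle(\beta_{jx})^{j\in J'},\mathrm{Pred}_{x},\mathrm{Post}_{x}\rangle:t\xrightarrow{\alpha_x}t_x$ of $A_2$, with the same set $J'$, such that $$\mathrm{Pred}_{s,t}\wedge\mathrm{Pred}_{OT}\implies\bigvee_{x\in X}\Big(\bigwedge_{j\in J'}\beta_j=\beta_{jx}\wedge\mathrm{Pred}_{x}\wedge\alpha=\alpha_x\wedge\mathrm{Pred}_{s',t_x}\{\mathrm{Post}_{OT}\uplus\mathrm{Post}_{x}\}\Big),$$ and symmetrically for the open transitions of $A_2$. Two pNets are \emph{FH-bisimilar} if there is an FH-bisimulation between their automata for which the predicate of the pair of initial states is verified by some valuation of their variables that agrees with the initial values, where there are any. \textbf{Theorem (Composability).} Let $P,P'$ be FH-bisimilar pNets and let $B\subseteq\mathrm{Holes}(P)=\mathrm{Holes}(P')$ be any set of holes. For each $j\in B$ let $Q_j,Q'_j$ be FH-bisimilar pNets with $\mathrm{Sort}(Q_j)=\mathrm{Sort}(Q'_j)=\mathrm{Sort}_j$, such that the holes of $Q_j$ are distinct from those in $\mathrm{Holes}(P)\setminus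 B$ and from those of $Q_{j'}$ for $j'\in B$, $j'\neq j$. Then $P[Q_j]_{j\in B}$ and $P'[Q'_j]_{j\in B}$ are pNets and they are FH-bisimilar. -/

import Mathlib

universe u

/-! ## Term algebra -/

/-- The (unspecified) algebra of data and actions: data values, data operators with their
interpretation, action labels, and the values that count as "true" when an expression is used
as a guard. -/
structure TermAlgebra : Type (u + 1) where
  Val : Type u
  Op : Type u
  arity : Op → ℕ
  interp : (o : Op) → (Fin (arity o) → Val) → Val
  Label : Type u
  holds : Val → Prop

/-- Expressions over a set `X` of variables: values, variables, operators applied to expressions.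
Every expression may be used as a guard. -/
inductive Expr (A : TermAlgebra.{u}) (X : Type u) : Type u
  | val (v : A.Val) : Expr A X
  | var (x : X) : Expr A X
  | op (o : A.Op) (args : Fin (A.arity o) → Expr A X) : Expr A X

namespace Expr

variable {A : TermAlgebra.{u}} {X Y : Type u}

/-- The variables of an expression. -/
def vars : Expr A X → Set X
  | val _ => ∅
  | var x => {x}
  | op _ args => ⋃ i, (args i).vars

/-- Parallel substitution of expressions for variables. -/
def subst (σ : X → Expr A Y) : Expr A X → Expr A Y
  | val v => val v
  | var x => σ x
  | op o args => op o fun i => (args i).subst σ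

/-- The value of an expression under a valuation of its variables. -/
def eval (ν : X → A.Val) : Expr A X → A.Val
  | val v => v
  | var x => ν x
  | op o args => A.interp o fun i => (args i).eval ν

end Expr

/-- ActTerm signatures: a label together with a number of parameters. -/
abbrev Sig (A : TermAlgebra.{u}) : Type u := A.Label × ℕ

/-- ActTerm terms `a(e₁, …, eₙ)` that do not distinguish input variables. -/
structure ActTerm (A : TermAlgebra.{u}) (X : Type u) : Type u where
  label : A.Label
  args : List (Expr A X)

namespace ActTerm

variable {A : TermAlgebra.{u}} {X Y : Type u}

/-- The variables of an action term. -/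
def vars (a : ActTerm A X) : Set X := {x | ∃ e ∈ a.args, x ∈ e.vars}

/-- The signature of an action term. -/
def sig (a : ActTerm A X) : Sig A := (a.label, a.args.length)

/-- Parallel substitution in an action term. -/
def subst (σ : X → Expr A Y) (a : ActTerm A X) : ActTerm A Y := ⟨a.label, a.args.map (Expr.subst σ)⟩

/-- Renaming of the variables of an action term. -/
def rename (f : X → Y) (a : ActTerm A X) : ActTerm A Y := a.subst fun x => Expr.var (f x)

/-- The value of an action term under a valuation. ActTerm labels are free constructors, so the
formula `a = b` holds under a valuation exactly if the values of `a` and `b` coincide. -/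
def eval (ν : X → A.Val) (a : ActTerm A X) : A.Label × List A.Val :=
  (a.label, a.args.map (Expr.eval ν))

end ActTerm

/-- ActTerm terms `a(p₁, …, pₙ)` that distinguish input variables: each parameter is either an
input variable `?x` (`Sum.inl x`) or an expression over the variables `V` (`Sum.inr e`). The type
`X` is the set of input variables of the term; an input variable occurs only once in it. -/
structure InputAction (A : TermAlgebra.{u}) (V X : Type u) : Type u where
  label : A.Label
  params : List (X ⊕ Expr A V)
  input_once : (params.filterMap Sum.getLeft?).Nodup
  input_occurs : ∀ x : X, Sum.inl x ∈ params

/-- Removal of the input markers. -/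
def InputAction.toAction {A : TermAlgebra.{u}} {V X : Type u} (a : InputAction A V X) :
    ActTerm A (V ⊕ X) :=
  ⟨a.label, a.params.map
    (Sum.elim (fun x => Expr.var (Sum.inr x)) (Expr.subst fun v => Expr.var (Sum.inl v)))⟩

/-! ## pLTSs and pNets -/

/-- A transition `s —⟨α, e_b, (x_j := e_j)⟩→ s'` of a pLTS with states `S` and variables `V`. The
type `X` is the set of input variables of `α`; the guard and the assigned expressions range over
`V` and these input variables, and only variables of `V` are assigned (`none`: not assigned). -/
structure PLTSTransition (A : TermAlgebra.{u}) (S V : Type u) : Type (u + 1) where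
  X : Type u
  src : S
  tgt : S
  act : InputAction A V X
  guard : Expr A (V ⊕ X)
  assign : V → Option (Expr A (V ⊕ X))

/-- A parameterised labelled transition system. A variable may have an initial value. -/
structure PLTS (A : TermAlgebra.{u}) : Type (u + 1) where
  S : Type u
  s₀ : S
  V : Type u
  init : V → Option A.Val
  trans : Set (PLTSTransition A S V)

/-- A synchronisation vector over the sub-pNets `I` and the holes `J`: a partial family of action
terms (its domain is the set of sub-pNets and holes that are involved), a global action and a
guard, over the vector's own variables `X`. -/
structure SyncVector (A : TermAlgebra.{u}) (I J : Type u) : Type (u + 1) where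
  X : Type u
  act : I ⊕ J → Option (ActTerm A X)
  global : ActTerm A X
  guard : Expr A X

/-- pNets: a pNet is a pLTS, or a node `⟨P_i^{i ∈ I}, Sort_j^{j ∈ J}, SV_k^{k ∈ K}⟩` with
sub-pNets indexed by `I`, holes indexed by `J`, and synchronisation vectors indexed by `K`. The
hole at index `j` bears the name `name j : H`; names serve to identify the holes of different
pNets. The side conditions are collected in `PNet.WellFormed`. -/
inductive PNet (A : TermAlgebra.{u}) (H : Type u) : Type (u + 1)
  | plts (L : PLTS A) : PNet A H
  | node (I J : Type u) (sub : I → PNet A H) (name : J → H) (sort : J → Set (Sig A))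
      (K : Type u) (sv : K → SyncVector A I J) : PNet A H

namespace PNet

variable {A : TermAlgebra.{u}} {H : Type u}

/-- The sort of a pNet: the signatures of the actions it can perform. -/
def sorts : PNet A H → Set (Sig A)
  | plts L => {x | ∃ t ∈ L.trans, x = t.act.toAction.sig}
  | node _ _ _ _ _ _ sv => {x | ∃ k, x = (sv k).global.sig}

/-- All the holes of a pNet, including those of its sub-pNets, each with its sort: the graph of
the family `Sort_j^{j ∈ Holes(P)}`. -/
def holes : PNet A H → Set (H × Set (Sig A))
  | plts _ => ∅
  | node _ _ sub name sort _ _ => (Set.range fun j => (name j, sort j)) ∪ ⋃ i, (sub i).holes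

/-- The set `Holes(P)` of the names of all the holes of a pNet. -/
def holeNames (P : PNet A H) : Set H := Prod.fst '' P.holes

/-- The side conditions of the definition of pNets. (Variables of different pLTSs are distinct by
construction, see `PNet.Vars`.) -/
def WellFormed : PNet A H → Prop
  | plts _ => True
  | node I J sub name sort _ sv =>
      Nonempty (I ⊕ J) ∧
      -- all holes, at all levels, have distinct names
      Function.Injective name ∧
      (∀ i, Disjoint (sub i).holeNames (Set.range name)) ∧
      (∀ i i', i ≠ i' → Disjoint (sub i).holeNames (sub i').holeNames) ∧
      -- the action terms of a vector belong to the sorts of the sub-pNets and holes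
      (∀ k i a, (sv k).act (Sum.inl i) = some a → a.sig ∈ (sub i).sorts) ∧
      (∀ k j a, (sv k).act (Sum.inr j) = some a → a.sig ∈ sort j) ∧
      -- the variables of the global action and of the guard occur in these action terms
      (∀ k, (sv k).global.vars ∪ (sv k).guard.vars ⊆
        {x | ∃ l a, (sv k).act l = some a ∧ x ∈ a.vars}) ∧
      ∀ i, (sub i).WellFormed

/-- Filling holes: each hole of `P` whose name belongs to `B` is filled with the pNet `Q` provides
for that name, i.e. it is moved from the holes to the sub-pNets of its node. -/
def fill (B : Set H) (Q : H → PNet A H) : PNet A H → PNet A H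
  | plts L => plts L
  | node I J sub name sort K sv =>
      node (I ⊕ {j : J // name j ∈ B}) {j : J // name j ∉ B}
        (Sum.elim (fun i => (sub i).fill B Q) (fun j => Q (name j.1)))
        (fun j => name j.1) (fun j => sort j.1) K
        (fun k =>
          { X := (sv k).X
            act := fun l => (sv k).act
              (Sum.elim (Sum.elim Sum.inl fun j => Sum.inr j.1) (fun j => Sum.inr j.1) l)
            global := (sv k).global
            guard := (sv k).guard })

/-- States of a pNet: the tuples of states of its leaves (grouped along the tree). -/
@[reducible] def State : PNet A H → Type u
  | plts L => L.S
  | node _ _ sub _ _ _ _ => ∀ i, (sub i).State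

/-- The initial state: the tuple of the initial states of the leaves. -/
def initState : (P : PNet A H) → P.State
  | plts L => L.s₀
  | node _ _ sub _ _ _ _ => fun i => (sub i).initState

/-- The variables of a pNet: the disjoint union of the variables of its leaves. -/
@[reducible] def Vars : PNet A H → Type u
  | plts L => L.V
  | node _ _ sub _ _ _ _ => Σ i, (sub i).Vars

/-- The initial values of the variables, where they have one. -/
def initVal : (P : PNet A H) → P.Vars → Option A.Val
  | plts L => L.init
  | node _ _ sub _ _ _ _ => fun v => (sub v.1).initVal v.2

end PNet

/-! ## Open automata -/

/-- Open transitions over hole names `H`, states `S` and automaton variables `V`, with free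
variables `F` (those variables of its terms that do not belong to the automaton). `β` is the
family of the actions of the holes that take part (its domain is `J'`). Predicates are taken
modulo logical equivalence, i.e. as predicates on valuations. `Post` is a parallel assignment
of variables of `V` (`none`: not assigned). -/
structure OpenTransition (A : TermAlgebra.{u}) (H S V F : Type u) : Type u where
  src : S
  tgt : S
  β : H → Option (ActTerm A (V ⊕ F))
  α : ActTerm A (V ⊕ F)
  Pred : (V ⊕ F → A.Val) → Prop
  Post : V → Option (Expr A (V ⊕ F))

namespace OpenTransition

variable {A : TermAlgebra.{u}} {H S V F F' : Type u}

/-- A substitution of the free variables, leaving the variables `V` unchanged. -/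
def liftSubst (σ : F → Expr A (V ⊕ F')) : V ⊕ F → Expr A (V ⊕ F') :=
  Sum.elim (fun v => Expr.var (Sum.inl v)) σ

/-- Refinement of an open transition: free variables are replaced by expressions, and the
predicate is strengthened. -/
def refine (o : OpenTransition A H S V F) (σ : F → Expr A (V ⊕ F'))
    (p : (V ⊕ F' → A.Val) → Prop) : OpenTransition A H S V F' where
  src := o.src
  tgt := o.tgt
  β := fun j => (o.β j).map (ActTerm.subst (liftSubst σ))
  α := o.α.subst (liftSubst σ)
  Pred := fun ν => o.Pred (fun x => (liftSubst σ x).eval ν) ∧ p ν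
  Post := fun v => (o.Post v).map (Expr.subst (liftSubst σ))

/-- The values of the variables `V` after the transition. -/
def update (o : OpenTransition A H S V F) (ν : V ⊕ F → A.Val) (v : V) : A.Val :=
  match o.Post v with
  | some e => e.eval ν
  | none => ν (Sum.inl v)

end OpenTransition

/-- Open automata. `holes` is the graph of the family of the sorts of the holes; `T F` is the set
of the transitions with free variables `F`. -/
structure OpenAutomaton (A : TermAlgebra.{u}) (H : Type u) : Type (u + 1) where
  holes : Set (H × Set (Sig A))
  S : Type u
  s₀ : S
  V : Type u
  init : V → Option A.Val
  T : (F : Type u) → Set (OpenTransition A H S V F)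
  hole_actions : ∀ (F : Type u), ∀ o ∈ T F, ∀ j b, o.β j = some b →
    ∃ τ, (j, τ) ∈ holes ∧ b.sig ∈ τ
  refine_mem : ∀ (F F' : Type u), ∀ o ∈ T F, ∀ (σ : F → Expr A (V ⊕ F'))
    (p : (V ⊕ F' → A.Val) → Prop), o.refine σ p ∈ T F'

/-- A relation over the states of two automata: to each pair of states `s`, `t` it associates a
predicate `Pred_{s,t}` over the variables of the two automata. The two sets of variables are made
disjoint by valuing them separately. -/
abbrev StateRel (A : TermAlgebra.{u}) {H : Type u} (A₁ A₂ : OpenAutomaton A H) : Type u :=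
  A₁.S → A₂.S → (A₁.V → A.Val) → (A₂.V → A.Val) → Prop

/-- One direction of FH-bisimulation: each open transition of `A₁` from `s` is covered by a set
`O` of open transitions of `A₂` from `t`. -/
def IsFHSimulation {A : TermAlgebra.{u}} {H : Type u} (A₁ A₂ : OpenAutomaton A H)
    (R : StateRel A A₁ A₂) : Prop :=
  ∀ (s : A₁.S) (t : A₂.S) (F : Type u), ∀ o ∈ A₁.T F, o.src = s →
    ∃ O : Set (OpenTransition A H A₂.S A₂.V F), O ⊆ A₂.T F ∧
      (∀ o' ∈ O, o'.src = t ∧ ∀ j, (o'.β j).isSome ↔ (o.β j).isSome) ∧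
      ∀ (ν₁ : A₁.V → A.Val) (ν₂ : A₂.V → A.Val) (φ : F → A.Val),
        R s t ν₁ ν₂ → o.Pred (Sum.elim ν₁ φ) →
        ∃ o' ∈ O,
          (∀ j b b', o.β j = some b → o'.β j = some b' →
            b.eval (Sum.elim ν₁ φ) = b'.eval (Sum.elim ν₂ φ)) ∧
          o'.Pred (Sum.elim ν₂ φ) ∧
          o.α.eval (Sum.elim ν₁ φ) = o'.α.eval (Sum.elim ν₂ φ) ∧
          R o.tgt o'.tgt (o.update (Sum.elim ν₁ φ)) (o'.update (Sum.elim ν₂ φ))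

/-- Strong FH-bisimulation between two open automata with the same holes of the same sorts. -/
def IsFHBisimulation {A : TermAlgebra.{u}} {H : Type u} (A₁ A₂ : OpenAutomaton A H)
    (R : StateRel A A₁ A₂) : Prop :=
  A₁.holes = A₂.holes ∧ IsFHSimulation A₁ A₂ R ∧
    IsFHSimulation A₂ A₁ fun t s ν₂ ν₁ => R s t ν₁ ν₂

/-! ## Semantics of pNets -/

section Semantics

variable {A : TermAlgebra.{u}} {H : Type u}

/-- The open transition of a pLTS given by one of its transitions (conclusion of the first
rule). -/
def PLTSTransition.toOpen {S V : Type u} (t : PLTSTransition A S V) :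
    OpenTransition A H S V t.X where
  src := t.src
  tgt := t.tgt
  β := fun _ => none
  α := t.act.toAction
  Pred := fun ν => A.holds (t.guard.eval ν)
  Post := t.assign

open Classical in
/-- The open transition of a node (conclusion of the second rule), from the open transitions `o i`
of the sub-pNets (only those of the sub-pNets involved in the vector are used) and actions `b j`
of the holes and `α` of the node over fresh variables `Y`. The free variables are the disjoint
union of those of the `o i`, those of the vector and `Y`. -/
def SyncVector.toOpen {I J : Type u} (w : SyncVector A I J) {S V F : I → Type u} {Y : Type u}
    (s s' : ∀ i, S i) (o : ∀ i, OpenTransition A H (S i) (V i) (F i))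
    (b : J → ActTerm A Y) (α : ActTerm A Y)
    (β : H → Option (ActTerm A ((Σ i, V i) ⊕ ((Σ i, F i) ⊕ (w.X ⊕ Y))))) :
    OpenTransition A H (∀ i, S i) (Σ i, V i) ((Σ i, F i) ⊕ (w.X ⊕ Y)) where
  src := s
  tgt := s'
  β := β
  α := α.rename fun y => Sum.inr (Sum.inr (Sum.inr y))
  Pred := fun ν =>
    let νsub (i : I) : V i ⊕ F i → A.Val :=
      fun x => ν (Sum.map (Sigma.mk i) (fun f => Sum.inl (Sigma.mk i f)) x)
    let νvec : w.X → A.Val := fun x => ν (Sum.inr (Sum.inr (Sum.inl x)))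
    let νY : Y → A.Val := fun y => ν (Sum.inr (Sum.inr (Sum.inr y)))
    (∀ i a, w.act (Sum.inl i) = some a →
      (o i).Pred (νsub i) ∧ (o i).α.eval (νsub i) = a.eval νvec) ∧
    (∀ j a, w.act (Sum.inr j) = some a → (b j).eval νY = a.eval νvec) ∧
    α.eval νY = w.global.eval νvec ∧
    A.holds (w.guard.eval νvec)
  Post := fun v =>
    if (w.act (Sum.inl v.1)).isSome then
      ((o v.1).Post v.2).map (Expr.subst fun x =>
        Expr.var (Sum.map (Sigma.mk v.1) (fun f => Sum.inl (Sigma.mk v.1 f)) x))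
    else none

/-- `P.Models F o`: the pNet `P` has the open transition `o` with free variables `F`. This is the
least relation closed under the two rules and under refinement. -/
inductive PNet.Models : (P : PNet A H) → (F : Type u) →
    OpenTransition A H P.State P.Vars F → Prop
  | tr1 (L : PLTS A) (t : PLTSTransition A L.S L.V) (ht : t ∈ L.trans) :
      PNet.Models (PNet.plts L) t.X t.toOpen
  | tr2 (I J : Type u) (sub : I → PNet A H) (name : J → H) (sort : J → Set (Sig A))
      (K : Type u) (sv : K → SyncVector A I J) (k : K)
      (s s' : ∀ i, (sub i).State) (F : I → Type u)
      (o : ∀ i, OpenTransition A H (sub i).State (sub i).Vars (F i))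
      -- the sub-pNets that are involved make the transition `o i`, the others do not move
      (ho : ∀ i, ((sv k).act (Sum.inl i)).isSome →
        PNet.Models (sub i) (F i) (o i))
      (hm : ∀ i, ((sv k).act (Sum.inl i)).isSome → (o i).src = s i ∧ (o i).tgt = s' i)
      (hs : ∀ i, (sv k).act (Sum.inl i) = none → s' i = s i)
      (Y : Type u) (b : J → ActTerm A Y) (α : ActTerm A Y)
      (hb : ∀ j, ((sv k).act (Sum.inr j)).isSome → (b j).sig ∈ sort j)
      -- `β` is the union of the families of hole actions of the sub-pNets and of the `b j`
      (β : H → Option (ActTerm A ((Σ i, (sub i).Vars) ⊕ ((Σ i, F i) ⊕ ((sv k).X ⊕ Y)))))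
      (hβ : ∀ h c, β h = some c ↔
        (∃ i c', ((sv k).act (Sum.inl i)).isSome ∧ (o i).β h = some c' ∧
          c = c'.rename (Sum.map (Sigma.mk i) fun f => Sum.inl (Sigma.mk i f))) ∨
        (∃ j, ((sv k).act (Sum.inr j)).isSome ∧ name j = h ∧
          c = (b j).rename fun y => Sum.inr (Sum.inr (Sum.inr y)))) :
      PNet.Models (PNet.node I J sub name sort K sv) _ ((sv k).toOpen s s' o b α β)
  | refine (P : PNet A H) (F F' : Type u) (o : OpenTransition A H P.State P.Vars F)
      (ho : PNet.Models P F o) (σ : F → Expr A (P.Vars ⊕ F'))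
      (p : (P.Vars ⊕ F' → A.Val) → Prop) :
      PNet.Models P F' (o.refine σ p)

theorem ActTerm.sig_subst {X Y : Type u} (σ : X → Expr A Y) (a : ActTerm A X) :
    (a.subst σ).sig = a.sig := by
  simp [ActTerm.sig, ActTerm.subst]

theorem ActTerm.sig_rename_mem {X Y : Type u} {f : X → Y} {a : ActTerm A X} {τ : Set (Sig A)}
    (h : a.sig ∈ τ) : (a.rename f).sig ∈ τ := by
  rwa [ActTerm.rename, ActTerm.sig_subst]

theorem PNet.Models.hole_actions {P : PNet A H} {F : Type u}
    {o : OpenTransition A H P.State P.Vars F} (h : P.Models F o) :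
    ∀ j b, o.β j = some b → ∃ τ, (j, τ) ∈ P.holes ∧ b.sig ∈ τ := by
  induction h with
  | tr1 L t ht => intro j b hb; cases hb
  | tr2 I J sub name sort K sv k s s' F o ho hm hs Y b α hb β hβ ih =>
    intro h c hc
    rcases (hβ h c).1 hc with ⟨i, c', hi, hc', rfl⟩ | ⟨j, hj, rfl, rfl⟩
    · obtain ⟨τ, h1, h2⟩ := ih i hi h c' hc'
      refine ⟨τ, Or.inr (Set.mem_iUnion.2 ⟨i, h1⟩), ?_⟩
      exact ActTerm.sig_rename_mem h2
    · refine ⟨sort j, Or.inl ⟨j, rfl⟩, ?_⟩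
      exact ActTerm.sig_rename_mem (hb j hj)
  | refine P F F' o ho σ p ih =>
    intro j b hb
    simp only [OpenTransition.refine, Option.map_eq_some_iff] at hb
    obtain ⟨b', hb', rfl⟩ := hb
    rw [ActTerm.sig_subst]
    exact ih j b' hb'

/-- The semantics of a pNet: an open automaton over its holes, states and variables. -/
def PNet.automaton (P : PNet A H) : OpenAutomaton A H where
  holes := P.holes
  S := P.State
  s₀ := P.initState
  V := P.Vars
  init := P.initVal
  T := fun F => {o | P.Models F o}
  hole_actions := fun _ _ ho => ho.hole_actions
  refine_mem := fun F F' o ho σ p => PNet.Models.refine P F F' o ho σ p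

/-- Two pNets are FH-bisimilar if some FH-bisimulation between their automata relates the initial
states, i.e. the predicate it associates to them is verified by some values of the variables that
agree with the initial values (where there are any). -/
def FHBisimilar (P P' : PNet A H) : Prop :=
  ∃ R : StateRel A P.automaton P'.automaton,
    IsFHBisimulation P.automaton P'.automaton R ∧
    ∃ (ν : P.Vars → A.Val) (ν' : P'.Vars → A.Val),
      (∀ v x, P.initVal v = some x → ν v = x) ∧
      (∀ v x, P'.initVal v = some x → ν' v = x) ∧
      R P.initState P'.initState ν ν'

end Semantics

/-! Predicates are sets of valuations, and the family that covers an open transition may be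
arbitrarily large. The implication defining FH-bisimulation therefore only says that, for each
valuation of the variables, some transition of the other automaton matches with the same values.
This makes FH-bisimulation an ordinary bisimulation on ground data: configurations (a state and a
value of every variable) and steps labelled by the values of the hole actions and of the global
action (`PNet.Step`).

`Models.step` and `Step.exists_models` relate steps to open transitions evaluated at a valuation.
The second rests on refinement: free variables may be replaced by constants, so any step is realised
over any set of free variables. The outcome is `fhBisimilar_iff`: FH-bisimilarity means equal holes
together with `ConfBisimilar`.

On steps, composability is a synchronisation argument. Filling leaves the vectors unchanged, so a
step of the filled pNet is a step of `P` together with, for each filled hole acting with value `b`,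
a step of its filling with global action `b`; the other fillings stay put. `Step.exists_of_fill`
decomposes and `Step.fill` recomposes. Given related components, one decomposes, answers the step of
`P` in `P'` with the same hole actions, answers each step of an active `Q h` in `Q' h`, and
recomposes (`IsConfSimulation.fill`). Distinctness of hole names is what makes this coherent: each
hole acts at most once in a step (`Step.hole_unique`), and choices made in different subtrees glue
together. -/

/-! ### Evaluation and substitution of terms -/

namespace Expr

variable {A : TermAlgebra.{u}} {X Y : Type u}

theorem eval_subst (σ : X → Expr A Y) (ν : Y → A.Val) (e : Expr A X) :
    (e.subst σ).eval ν = e.eval fun x => (σ x).eval ν := by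
  induction e with
  | val v => rfl
  | var x => rfl
  | op o args ih => simp only [subst, eval, ih]

end Expr

/-- Values of action terms. -/
abbrev GroundAction (A : TermAlgebra.{u}) : Type u := A.Label × List A.Val

namespace ActTerm

variable {A : TermAlgebra.{u}} {X Y : Type u}

theorem eval_subst (σ : X → Expr A Y) (ν : Y → A.Val) (a : ActTerm A X) :
    (a.subst σ).eval ν = a.eval fun x => (σ x).eval ν := by
  simp only [subst, eval, List.map_map, Prod.mk.injEq, true_and]
  exact List.map_congr_left fun e _ => Expr.eval_subst σ ν e

theorem eval_rename (f : X → Y) (ν : Y → A.Val) (a : ActTerm A X) :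
    (a.rename f).eval ν = a.eval fun x => ν (f x) :=
  eval_subst _ _ _

/-- The action term without variables that denotes a given value. -/
def ofGround (g : GroundAction A) : ActTerm A X := ⟨g.1, g.2.map Expr.val⟩

theorem eval_ofGround (g : GroundAction A) (ν : X → A.Val) : (ofGround g).eval ν = g := by
  have h : Expr.eval ν ∘ Expr.val = id := rfl
  simp [ofGround, eval, h]

theorem sig_ofGround_eval (a : ActTerm A X) (ν : X → A.Val) :
    (ofGround (a.eval ν) : ActTerm A Y).sig = a.sig := by
  simp [ofGround, eval, sig]

end ActTerm

/-! ### Open transitions at a valuation -/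

namespace OpenTransition

variable {A : TermAlgebra.{u}} {H S V F F' : Type u}

/-- The hole actions of an open transition under a valuation. -/
def holeGraph (o : OpenTransition A H S V F) (μ : V ⊕ F → A.Val) : Set (H × GroundAction A) :=
  {p | ∃ b, o.β p.1 = some b ∧ b.eval μ = p.2}

/-- With the next two lemmas: equality of hole graphs packs into one equation of sets the two
requirements of FH-simulation on hole actions, the same set `J'` and equal values on it. -/
theorem isSome_iff_of_holeGraph_eq {S' V' : Type u} {o : OpenTransition A H S V F}
    {o' : OpenTransition A H S' V' F'} {μ : V ⊕ F → A.Val} {μ' : V' ⊕ F' → A.Val}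
    (h : o.holeGraph μ = o'.holeGraph μ') (j : H) : (o.β j).isSome ↔ (o'.β j).isSome := by
  simp only [Option.isSome_iff_exists]
  constructor
  · rintro ⟨b, hb⟩
    obtain ⟨b', hb', -⟩ := h.subset (show (j, b.eval μ) ∈ o.holeGraph μ from ⟨b, hb, rfl⟩)
    exact ⟨b', hb'⟩
  · rintro ⟨b, hb⟩
    obtain ⟨b', hb', -⟩ :=
      h.symm.subset (show (j, b.eval μ') ∈ o'.holeGraph μ' from ⟨b, hb, rfl⟩)
    exact ⟨b', hb'⟩

theorem eval_eq_of_holeGraph_eq {S' V' : Type u} {o : OpenTransition A H S V F}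
    {o' : OpenTransition A H S' V' F'} {μ : V ⊕ F → A.Val} {μ' : V' ⊕ F' → A.Val}
    (h : o.holeGraph μ = o'.holeGraph μ') {j : H} {b : ActTerm A (V ⊕ F)}
    {b' : ActTerm A (V' ⊕ F')} (hb : o.β j = some b) (hb' : o'.β j = some b') :
    b.eval μ = b'.eval μ' := by
  obtain ⟨c, hc, hc'⟩ := h.subset (show (j, b.eval μ) ∈ o.holeGraph μ from ⟨b, hb, rfl⟩)
  rw [hb', Option.some.injEq] at hc
  exact hc'.symm.trans (by rw [hc])

theorem holeGraph_eq {S' V' : Type u} {o : OpenTransition A H S V F}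
    {o' : OpenTransition A H S' V' F'} {μ : V ⊕ F → A.Val} {μ' : V' ⊕ F' → A.Val}
    (hd : ∀ j, (o'.β j).isSome ↔ (o.β j).isSome)
    (he : ∀ j b b', o.β j = some b → o'.β j = some b' → b.eval μ = b'.eval μ') :
    o.holeGraph μ = o'.holeGraph μ' := by
  ext ⟨j, g⟩
  constructor
  · rintro ⟨b, hb, rfl⟩
    obtain ⟨b', hb'⟩ := Option.isSome_iff_exists.1 ((hd j).2 (Option.isSome_iff_exists.2 ⟨b, hb⟩))
    exact ⟨b', hb', (he j b b' hb hb').symm⟩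
  · rintro ⟨b', hb', rfl⟩
    obtain ⟨b, hb⟩ := Option.isSome_iff_exists.1 ((hd j).1 (Option.isSome_iff_exists.2 ⟨b', hb'⟩))
    exact ⟨b, hb, he j b b' hb hb'⟩

/-- The valuation of the variables before a substitution that is induced by one after it. -/
def substVal (σ : F → Expr A (V ⊕ F')) (μ : V ⊕ F' → A.Val) : V ⊕ F → A.Val :=
  fun x => (liftSubst σ x).eval μ

theorem holeGraph_refine (o : OpenTransition A H S V F) (σ : F → Expr A (V ⊕ F'))
    (p : (V ⊕ F' → A.Val) → Prop) (μ : V ⊕ F' → A.Val) :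
    (o.refine σ p).holeGraph μ = o.holeGraph (substVal σ μ) := by
  ext ⟨j, g⟩
  simp only [holeGraph, refine, Option.map_eq_some_iff, Set.mem_ofPred_eq]
  constructor
  · rintro ⟨_, ⟨b, hb, rfl⟩, rfl⟩
    exact ⟨b, hb, (ActTerm.eval_subst _ _ _).symm⟩
  · rintro ⟨b, hb, rfl⟩
    exact ⟨_, ⟨b, hb, rfl⟩, ActTerm.eval_subst _ _ _⟩

theorem update_refine (o : OpenTransition A H S V F) (σ : F → Expr A (V ⊕ F'))
    (p : (V ⊕ F' → A.Val) → Prop) (μ : V ⊕ F' → A.Val) :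
    (o.refine σ p).update μ = o.update (substVal σ μ) := by
  funext v
  cases h : o.Post v with
  | none => simp [update, refine, h, substVal, liftSubst, Expr.eval]
  | some e => simp only [update, refine, h, Option.map_some, Expr.eval_subst]; rfl

end OpenTransition

/-! ### Configurations and ground steps -/

namespace PNet

variable {A : TermAlgebra.{u}} {H : Type u}

/-- Configurations of a pNet: a state and a value of the variables, leaf by leaf. -/
def Conf : PNet A H → Type u
  | plts L => L.S × (L.V → A.Val)
  | node _ _ sub _ _ _ _ => ∀ i, (sub i).Conf

/-- The configuration with given state and values of the variables. -/
def mkConf : (P : PNet A H) → P.State → (P.Vars → A.Val) → P.Conf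
  | plts _, s, ν => (s, ν)
  | node _ _ sub _ _ _ _, s, ν => fun i => (sub i).mkConf (s i) fun v => ν ⟨i, v⟩

/-- The state of a configuration. -/
def confState : (P : PNet A H) → P.Conf → P.State
  | plts _, c => c.1
  | node _ _ sub _ _ _ _, c => fun i => (sub i).confState (c i)

/-- The values of the variables in a configuration. -/
def confVal : (P : PNet A H) → P.Conf → P.Vars → A.Val
  | plts _, c => c.2
  | node _ _ sub _ _ _ _, c => fun v => (sub v.1).confVal (c v.1) v.2

/-- With the next two lemmas, configurations are in bijection with pairs of a state and a valuation.
The leafwise form makes the configurations of a node a product over its sub-pNets, which suits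
induction and filling. -/
theorem mkConf_confState_confVal (P : PNet A H) (c : P.Conf) :
    P.mkConf (P.confState c) (P.confVal c) = c := by
  induction P with
  | plts L => rfl
  | node I J sub name sort K sv ih => exact funext fun i => ih i (c i)

theorem confState_mkConf (P : PNet A H) (s : P.State) (ν : P.Vars → A.Val) :
    P.confState (P.mkConf s ν) = s := by
  induction P with
  | plts L => rfl
  | node I J sub name sort K sv ih => exact funext fun i => ih i (s i) _

theorem confVal_mkConf (P : PNet A H) (s : P.State) (ν : P.Vars → A.Val) :
    P.confVal (P.mkConf s ν) = ν := by
  induction P with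
  | plts L => rfl
  | node I J sub name sort K sv ih =>
    exact funext fun v => congrFun (ih v.1 (s v.1) fun w => ν ⟨v.1, w⟩) v.2

/-- Initial configurations. -/
def IsInit : (P : PNet A H) → P.Conf → Prop
  | plts L, c => c.1 = L.s₀ ∧ ∀ v x, L.init v = some x → c.2 v = x
  | node _ _ sub _ _ _ _, c => ∀ i, (sub i).IsInit (c i)

theorem isInit_mkConf (P : PNet A H) (ν : P.Vars → A.Val)
    (h : ∀ v x, P.initVal v = some x → ν v = x) : P.IsInit (P.mkConf P.initState ν) := by
  induction P with
  | plts L => exact ⟨rfl, h⟩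
  | node I J sub name sort K sv ih => exact fun i => ih i _ fun v x hv => h ⟨i, v⟩ x hv

theorem IsInit.confState_eq {P : PNet A H} {c : P.Conf} (h : P.IsInit c) :
    P.confState c = P.initState := by
  induction P with
  | plts L => exact h.1
  | node I J sub name sort K sv ih => exact funext fun i => ih i (h i)

theorem IsInit.confVal_eq {P : PNet A H} {c : P.Conf} (h : P.IsInit c) (v : P.Vars) (x : A.Val)
    (hx : P.initVal v = some x) : P.confVal c v = x := by
  induction P with
  | plts L => exact h.2 v x hx
  | node I J sub name sort K sv ih => exact ih v.1 (h v.1) v.2 hx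

/-- The transitions between configurations, with the values of the actions of the holes and of
the global action. -/
def Step : (P : PNet A H) → P.Conf → Set (H × GroundAction A) → GroundAction A → P.Conf → Prop
  | plts L, c, β, a, c' => ∃ t ∈ L.trans, ∃ φ : t.X → A.Val, t.src = c.1 ∧ t.tgt = c'.1 ∧ β = ∅ ∧
      t.act.toAction.eval (Sum.elim c.2 φ) = a ∧ A.holds (t.guard.eval (Sum.elim c.2 φ)) ∧
      c'.2 = fun v => ((t.assign v).map (Expr.eval (Sum.elim c.2 φ))).getD (c.2 v)
  | node I _ sub name _ _ sv, c, β, a, c' => ∃ k, ∃ (ν : (sv k).X → A.Val)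
      (βs : I → Set (H × GroundAction A)),
      (∀ i x, (sv k).act (Sum.inl i) = some x → (sub i).Step (c i) (βs i) (x.eval ν) (c' i)) ∧
      (∀ i, (sv k).act (Sum.inl i) = none → c' i = c i) ∧
      (sv k).global.eval ν = a ∧ A.holds ((sv k).guard.eval ν) ∧
      β = {p | (∃ i, ((sv k).act (Sum.inl i)).isSome ∧ p ∈ βs i) ∨
        ∃ j x, (sv k).act (Sum.inr j) = some x ∧ p = (name j, x.eval ν)}

/-! ### Steps versus open transitions -/

/-- Soundness, by induction on the derivation. The valuation supplies the inputs of a pLTS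
transition and the variables of a vector; a refinement only pulls the valuation back along its
substitution. -/
theorem Models.step {P : PNet A H} {F : Type u} {o : OpenTransition A H P.State P.Vars F}
    (h : P.Models F o) (μ : P.Vars ⊕ F → A.Val) (hp : o.Pred μ) :
    P.Step (P.mkConf o.src fun v => μ (Sum.inl v)) (o.holeGraph μ) (o.α.eval μ)
      (P.mkConf o.tgt (o.update μ)) := by
  induction h with
  | tr1 L t ht =>
    have hμ : Sum.elim (fun v => μ (Sum.inl v)) (fun x => μ (Sum.inr x)) = μ := by
      funext x; cases x <;> rfl
    refine ⟨t, ht, fun x => μ (Sum.inr x), rfl, rfl, ?_, ?_, ?_, ?_⟩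
    · ext p; simp [OpenTransition.holeGraph, PLTSTransition.toOpen]
    · simp only [mkConf, hμ]; rfl
    · simp only [mkConf, hμ]; exact hp
    · funext v
      simp only [mkConf, hμ, OpenTransition.update, PLTSTransition.toOpen]
      cases t.assign v <;> rfl
  | tr2 I J sub name sort K sv k s s' F o ho hm hs Y b α hb β hβ ih =>
    obtain ⟨h1, h2, h3, h4⟩ := hp
    refine ⟨k, fun x => μ (Sum.inr (Sum.inr (Sum.inl x))), fun i => (o i).holeGraph
      fun x => μ (Sum.map (Sigma.mk i) (fun f => Sum.inl (Sigma.mk i f)) x), ?_, ?_, ?_, h4, ?_⟩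
    · intro i x hx
      have hi : ((sv k).act (Sum.inl i)).isSome := by rw [hx]; rfl
      obtain ⟨h5, h6⟩ := h1 i x hx
      have := ih i hi _ h5
      rw [h6, (hm i hi).1, (hm i hi).2] at this
      convert this using 1
      · rfl
      refine congrArg ((sub i).mkConf (s' i)) (funext fun v => ?_)
      simp only [OpenTransition.update, SyncVector.toOpen, hi, if_true]
      cases (o i).Post v with
      | none => rfl
      | some e => exact Expr.eval_subst _ _ _
    · intro i hi
      change (sub i).mkConf (s' i) _ = (sub i).mkConf (s i) _
      rw [hs i hi]
      refine congrArg ((sub i).mkConf (s i)) (funext fun v => ?_)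
      simp [OpenTransition.update, SyncVector.toOpen, hi]
    · rw [← h3]; exact (ActTerm.eval_rename _ _ _).symm
    · ext ⟨h, g⟩
      constructor
      · rintro ⟨c, hc, rfl⟩
        rcases (hβ h c).1 hc with ⟨i, c', hi, hc', rfl⟩ | ⟨j, hj, rfl, rfl⟩
        · exact Or.inl ⟨i, hi, c', hc', (ActTerm.eval_rename _ _ _).symm⟩
        · obtain ⟨x, hx⟩ := Option.isSome_iff_exists.1 hj
          refine Or.inr ⟨j, x, hx, ?_⟩
          rw [← h2 j x hx, ActTerm.eval_rename]
      · rintro (⟨i, hi, c', hc', hg⟩ | ⟨j, x, hx, hg⟩)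
        · exact ⟨_, (hβ h _).2 (Or.inl ⟨i, c', hi, hc', rfl⟩),
            (ActTerm.eval_rename _ _ _).trans hg⟩
        · rw [Prod.mk.injEq] at hg
          refine ⟨_, (hβ h _).2 (Or.inr ⟨j, by rw [hx]; rfl, hg.1.symm, rfl⟩), ?_⟩
          rw [ActTerm.eval_rename, hg.2, ← h2 j x hx]
  | refine P F F' o ho σ p ih =>
    rw [OpenTransition.holeGraph_refine, OpenTransition.update_refine]
    have := ih (OpenTransition.substVal σ μ) hp.1
    rwa [← show ((o.refine σ p).α.eval μ) = o.α.eval (OpenTransition.substVal σ μ) from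
      ActTerm.eval_subst _ _ _] at this

/-- The free variables of an open transition may be replaced by their values. -/
theorem Models.ground {P : PNet A H} {F : Type u} {o : OpenTransition A H P.State P.Vars F}
    (h : P.Models F o) (μ : P.Vars ⊕ F → A.Val) (hp : o.Pred μ) (F' : Type u)
    (μ' : P.Vars ⊕ F' → A.Val) (hμ : ∀ v, μ' (Sum.inl v) = μ (Sum.inl v)) :
    ∃ o' : OpenTransition A H P.State P.Vars F', P.Models F' o' ∧ o'.src = o.src ∧
      o'.tgt = o.tgt ∧ o'.Pred μ' ∧ o'.holeGraph μ' = o.holeGraph μ ∧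
      o'.α.eval μ' = o.α.eval μ ∧ o'.update μ' = o.update μ := by
  -- Once the free variables are replaced by the constants `μ` gives them, the pulled-back valuation
  -- is `μ`, whatever `μ'` does on `F'`.
  have hs : OpenTransition.substVal (fun f => Expr.val (μ (Sum.inr f))) μ' = μ := by
    funext x
    cases x with
    | inl v => exact hμ v
    | inr f => rfl
  refine ⟨_, Models.refine P F F' o h (fun f => Expr.val (μ (Sum.inr f))) fun _ => True,
    rfl, rfl, ⟨?_, trivial⟩, ?_, ?_, ?_⟩
  · exact (congrArg o.Pred hs).mpr hp
  · rw [OpenTransition.holeGraph_refine, hs]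
  · exact (ActTerm.eval_subst _ _ _).trans (congrArg o.α.eval hs)
  · rw [OpenTransition.update_refine, hs]

theorem mem_holeNames_of_mem {P : PNet A H} {h : H} {τ : Set (Sig A)} (hh : (h, τ) ∈ P.holes) :
    h ∈ P.holeNames := ⟨_, hh, rfl⟩

theorem Models.mem_holeNames {P : PNet A H} {F : Type u}
    {o : OpenTransition A H P.State P.Vars F} (h : P.Models F o) {j : H}
    {b : ActTerm A (P.Vars ⊕ F)} (hb : o.β j = some b) : j ∈ P.holeNames := by
  obtain ⟨τ, hτ, -⟩ := h.hole_actions j b hb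
  exact mem_holeNames_of_mem hτ

/-- The node rule specifies its family of hole actions only through its graph; this produces the
family. -/
theorem exists_option_graph {α γ : Type*} (r : α → γ → Prop)
    (hr : ∀ a c c', r a c → r a c' → c = c') :
    ∃ f : α → Option γ, ∀ a c, f a = some c ↔ r a c := by
  have h : ∀ a, ∃ x : Option γ, ∀ c, x = some c ↔ r a c := by
    intro a
    by_cases ha : ∃ c, r a c
    · obtain ⟨c, hc⟩ := ha
      refine ⟨some c, fun c' => ?_⟩
      rw [Option.some.injEq]
      exact ⟨fun e => e ▸ hc, hr a c c' hc⟩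
    · exact ⟨none, fun c => ⟨fun e => by simp at e, fun e => (ha ⟨c, e⟩).elim⟩⟩
  choose f hf using h
  exact ⟨f, hf⟩

theorem Step.exists_models {P : PNet A H} (hP : P.WellFormed) {c c' : P.Conf}
    {β : Set (H × GroundAction A)} {a : GroundAction A} (h : P.Step c β a c') (F : Type u)
    (φ : F → A.Val) :
    ∃ o : OpenTransition A H P.State P.Vars F, P.Models F o ∧ o.src = P.confState c ∧
      o.tgt = P.confState c' ∧ o.Pred (Sum.elim (P.confVal c) φ) ∧
      o.holeGraph (Sum.elim (P.confVal c) φ) = β ∧ o.α.eval (Sum.elim (P.confVal c) φ) = a ∧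
      o.update (Sum.elim (P.confVal c) φ) = P.confVal c' := by
  induction P generalizing β a F φ with
  | plts L =>
    obtain ⟨t, ht, ψ, hs, ht', rfl, ha, hg, hv⟩ := h
    obtain ⟨o, ho, h1, h2, h3, h4, h5, h6⟩ := (Models.tr1 (H := H) L t ht).ground
      (Sum.elim c.2 ψ) hg F (Sum.elim c.2 φ) fun v => rfl
    refine ⟨o, ho, h1.trans hs, h2.trans ht', h3, h4.trans ?_, h5.trans ha, h6.trans ?_⟩
    · ext p; simp [OpenTransition.holeGraph, PLTSTransition.toOpen]
    · refine Eq.trans ?_ hv.symm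
      funext v
      simp only [OpenTransition.update, PLTSTransition.toOpen]
      cases t.assign v <;> rfl
  | node I J sub name sort K sv ih =>
    obtain ⟨k, ν, βs, hi, hn, ha, hg, rfl⟩ := h
    obtain ⟨-, hinj, hd, hdd, -, hsort, -, hwf⟩ := hP
    -- Premises without free variables suffice. The node rule takes a total family, so idle
    -- sub-pNets receive a dummy transition that is never used; likewise for idle holes in `H2`.
    have H1 : ∀ i, ∃ o : OpenTransition A H (sub i).State (sub i).Vars PEmpty.{u + 1},
        ∀ x, (sv k).act (Sum.inl i) = some x → (sub i).Models PEmpty o ∧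
          o.src = (sub i).confState (c i) ∧ o.tgt = (sub i).confState (c' i) ∧
          o.Pred (Sum.elim ((sub i).confVal (c i)) PEmpty.elim) ∧
          o.holeGraph (Sum.elim ((sub i).confVal (c i)) PEmpty.elim) = βs i ∧
          o.α.eval (Sum.elim ((sub i).confVal (c i)) PEmpty.elim) = x.eval ν ∧
          o.update (Sum.elim ((sub i).confVal (c i)) PEmpty.elim) = (sub i).confVal (c' i) := by
      intro i
      cases hx : (sv k).act (Sum.inl i) with
      | none =>
        exact ⟨⟨(sub i).confState (c i), (sub i).confState (c i), fun _ => none,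
          ActTerm.ofGround a, fun _ => True, fun _ => none⟩, fun x hx => by simp at hx⟩
      | some x =>
        obtain ⟨o, ho⟩ := ih i (hwf i) (hi i x hx) PEmpty PEmpty.elim
        exact ⟨o, fun y hy => by cases hy; exact ho⟩
    choose o ho using H1
    have H2 : ∀ j, ∃ b : ActTerm A PEmpty.{u + 1}, ∀ x, (sv k).act (Sum.inr j) = some x →
        b = ActTerm.ofGround (x.eval ν) := by
      intro j
      cases hx : (sv k).act (Sum.inr j) with
      | none => exact ⟨ActTerm.ofGround a, fun x hx => by simp at hx⟩
      | some x => exact ⟨_, fun y hy => by cases hy; rfl⟩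
    choose b hb using H2
    have hname : ∀ i h c', ((sv k).act (Sum.inl i)).isSome → (o i).β h = some c' →
        h ∈ (sub i).holeNames := by
      intro i h c' hx hc'
      obtain ⟨x, hx⟩ := Option.isSome_iff_exists.1 hx
      exact (ho i x hx).1.mem_holeNames hc'
    -- Single-valuedness: a name lies in only one sub-pNet or is a hole of the node itself, never
    -- both.
    obtain ⟨β, hβ⟩ := exists_option_graph (fun (h : H)
        (c : ActTerm A ((Σ i, (sub i).Vars) ⊕
          ((Σ _ : I, PEmpty.{u + 1}) ⊕ ((sv k).X ⊕ PEmpty.{u + 1})))) =>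
        (∃ i c', ((sv k).act (Sum.inl i)).isSome ∧ (o i).β h = some c' ∧
          c = c'.rename (Sum.map (Sigma.mk i) fun f => Sum.inl (Sigma.mk i f))) ∨
        (∃ j, ((sv k).act (Sum.inr j)).isSome ∧ name j = h ∧
          c = (b j).rename fun y => Sum.inr (Sum.inr (Sum.inr y)))) (by
      rintro h _ _ (⟨i, c₁, hi₁, h₁, rfl⟩ | ⟨j, hj, rfl, rfl⟩)
        (⟨i', c₂, hi₂, h₂, rfl⟩ | ⟨j', hj', e, rfl⟩)
      · have : i = i' := by
          by_contra hne
          exact Set.disjoint_left.1 (hdd i i' hne) (hname _ _ _ hi₁ h₁) (hname _ _ _ hi₂ h₂)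
        subst this
        rw [h₁, Option.some.injEq] at h₂
        rw [h₂]
      · exact (Set.disjoint_left.1 (hd i) (hname _ _ _ hi₁ h₁) ⟨j', e⟩).elim
      · exact (Set.disjoint_left.1 (hd i') (hname _ _ _ hi₂ h₂) ⟨j, rfl⟩).elim
      · rw [hinj e])
    have hM := Models.tr2 I J sub name sort K sv k (fun i => (sub i).confState (c i))
      (fun i => (sub i).confState (c' i)) (fun _ => PEmpty) o
      (fun i hx => by
        obtain ⟨x, hx⟩ := Option.isSome_iff_exists.1 hx
        exact (ho i x hx).1)
      (fun i hx => by
        obtain ⟨x, hx⟩ := Option.isSome_iff_exists.1 hx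
        exact ⟨(ho i x hx).2.1, (ho i x hx).2.2.1⟩)
      (fun i hx => by rw [hn i hx]) PEmpty b (ActTerm.ofGround a)
      (fun j hx => by
        obtain ⟨x, hx⟩ := Option.isSome_iff_exists.1 hx
        rw [hb j x hx, ActTerm.sig_ofGround_eval]
        exact hsort k j x hx) β hβ
    -- Only the variables of the vector are truly free here; they take the values `ν` recorded in
    -- the step.
    set μ : (Σ i, (sub i).Vars) ⊕ ((Σ _ : I, PEmpty.{u + 1}) ⊕ ((sv k).X ⊕ PEmpty.{u + 1})) →
        A.Val := Sum.elim (fun v => (sub v.1).confVal (c v.1) v.2)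
      (Sum.elim (fun f => PEmpty.elim f.2) (Sum.elim ν PEmpty.elim)) with hμ
    have hsub : ∀ i, (fun x : (sub i).Vars ⊕ PEmpty.{u + 1} =>
        μ (Sum.map (Sigma.mk i) (fun f => Sum.inl (Sigma.mk i f)) x)) =
        Sum.elim ((sub i).confVal (c i)) PEmpty.elim := by
      intro i; funext x
      rcases x with v | f
      · rfl
      · exact f.elim
    -- Grounding removes the vector's variables and makes `F` the set of free variables.
    obtain ⟨o', ho', h1, h2, h3, h4, h5, h6⟩ := hM.ground μ (by
      refine ⟨?_, ?_, ActTerm.eval_ofGround _ _ |>.trans ha.symm, hg⟩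
      · intro i x hx
        obtain ⟨-, -, -, g1, -, g2, -⟩ := ho i x hx
        exact ⟨(congrArg (o i).Pred (hsub i)).mpr g1,
          (congrArg (o i).α.eval (hsub i)).trans g2⟩
      · intro j x hx
        rw [hb j x hx]
        exact ActTerm.eval_ofGround _ _) F
      (Sum.elim (fun v => (sub v.1).confVal (c v.1) v.2) φ) fun v => rfl
    refine ⟨o', ho', h1, h2, h3, h4.trans ?_, h5.trans ?_, h6.trans ?_⟩
    · ext ⟨h, g⟩
      constructor
      · rintro ⟨d, hd, rfl⟩
        rcases (hβ h d).1 hd with ⟨i, d', hi', hd', rfl⟩ | ⟨j, hj, rfl, rfl⟩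
        · obtain ⟨x, hx⟩ := Option.isSome_iff_exists.1 hi'
          refine Or.inl ⟨i, hi', ?_⟩
          rw [← (ho i x hx).2.2.2.2.1]
          exact ⟨d', hd', by rw [ActTerm.eval_rename, hsub i]⟩
        · obtain ⟨x, hx⟩ := Option.isSome_iff_exists.1 hj
          refine Or.inr ⟨j, x, hx, ?_⟩
          rw [ActTerm.eval_rename, hb j x hx, ActTerm.eval_ofGround]
      · rintro (⟨i, hi', hp⟩ | ⟨j, x, hx, hp⟩)
        · obtain ⟨x, hx⟩ := Option.isSome_iff_exists.1 hi'
          rw [← (ho i x hx).2.2.2.2.1] at hp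
          obtain ⟨d', hd', e⟩ := hp
          exact ⟨_, (hβ h _).2 (Or.inl ⟨i, d', hi', hd', rfl⟩),
            by rw [ActTerm.eval_rename, hsub i]; exact e⟩
        · rw [Prod.mk.injEq] at hp
          refine ⟨_, (hβ h _).2 (Or.inr ⟨j, by rw [hx]; rfl, hp.1.symm, rfl⟩), ?_⟩
          rw [ActTerm.eval_rename, hb j x hx, ActTerm.eval_ofGround, hp.2]
    · exact (ActTerm.eval_rename _ _ _).trans (ActTerm.eval_ofGround _ _)
    · funext ⟨i, v⟩
      cases hx : (sv k).act (Sum.inl i) with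
      | none =>
        simp only [OpenTransition.update, SyncVector.toOpen, hx]
        change (sub i).confVal (c i) v = (sub i).confVal (c' i) v
        rw [hn i hx]
      | some x =>
        refine Eq.trans ?_ (congrFun (ho i x hx).2.2.2.2.2.2 v)
        simp only [OpenTransition.update, SyncVector.toOpen, hx, Option.isSome_some, if_true]
        cases (o i).Post v with
        | none => rfl
        | some e =>
          refine (Expr.eval_subst _ _ _).trans ?_
          exact congrArg (fun m => e.eval m) (hsub i)

end PNet

namespace PNet

variable {A : TermAlgebra.{u}} {H : Type u}

/-! ## Bisimulation of configurations -/

/-- Simulation between the configurations of two pNets. -/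
def IsConfSimulation (P P' : PNet A H) (R : P.Conf → P'.Conf → Prop) : Prop :=
  ∀ c d β a c', R c d → P.Step c β a c' → ∃ d', P'.Step d β a d' ∧ R c' d'

/-- A step is an open transition at one valuation, and that valuation selects one member of the
covering family. No free variables are needed, hence `PEmpty`. -/
theorem isConfSimulation_of_isFHSimulation {P P' : PNet A H} (hP : P.WellFormed)
    {R : P.State → P'.State → (P.Vars → A.Val) → (P'.Vars → A.Val) → Prop}
    (h : IsFHSimulation P.automaton P'.automaton R) :
    IsConfSimulation P P' fun c d =>
      R (P.confState c) (P'.confState d) (P.confVal c) (P'.confVal d) := by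
  intro c d β a c' hR hs
  obtain ⟨o, ho, h1, h2, h3, h4, h5, h6⟩ := hs.exists_models hP PEmpty PEmpty.elim
  obtain ⟨O, hO, hO', hc⟩ := h (P.confState c) (P'.confState d) PEmpty o ho h1
  obtain ⟨o', hM, hsrc, hβ, g2, g3, g4⟩ :
      ∃ o' : OpenTransition A H P'.State P'.Vars PEmpty.{u + 1}, P'.Models PEmpty o' ∧
        o'.src = P'.confState d ∧
        o.holeGraph (Sum.elim (P.confVal c) PEmpty.elim) =
          o'.holeGraph (Sum.elim (P'.confVal d) PEmpty.elim) ∧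
        o'.Pred (Sum.elim (P'.confVal d) PEmpty.elim) ∧
        o.α.eval (Sum.elim (P.confVal c) PEmpty.elim) =
          o'.α.eval (Sum.elim (P'.confVal d) PEmpty.elim) ∧
        R o.tgt o'.tgt (o.update (Sum.elim (P.confVal c) PEmpty.elim))
          (o'.update (Sum.elim (P'.confVal d) PEmpty.elim)) := by
    obtain ⟨o', ho', g1, g⟩ := hc (P.confVal c) (P'.confVal d) PEmpty.elim hR h3
    exact ⟨o', hO ho', (hO' o' ho').1, OpenTransition.holeGraph_eq (hO' o' ho').2 g1, g⟩
  refine ⟨P'.mkConf o'.tgt (o'.update (Sum.elim (P'.confVal d) PEmpty.elim)), ?_, ?_⟩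
  · have e := P'.mkConf_confState_confVal d
    have := hM.step _ g2
    rw [hsrc, ← hβ, ← g3, h4, h5] at this
    simp only [Sum.elim_inl] at this
    rwa [e] at this
  · change R _ _ _ _
    rw [confState_mkConf, confVal_mkConf, ← h2, ← h6]
    exact g4

/-- The answering step depends on the valuation, so no single open transition need suffice; a family
indexed by all possible answers does. -/
theorem isFHSimulation_of_isConfSimulation {P P' : PNet A H} (hP' : P'.WellFormed)
    {R : P.Conf → P'.Conf → Prop} (h : IsConfSimulation P P' R) :
    IsFHSimulation P.automaton P'.automaton fun s t ν₁ ν₂ =>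
      R (P.mkConf s ν₁) (P'.mkConf t ν₂) := by
  intro (s : P.State) (t : P'.State) F o ho hs
  -- The largest admissible family: every transition from `t` whose acting holes are those of `o`.
  refine ⟨{o' | P'.Models F o' ∧ o'.src = t ∧ ∀ j, (o'.β j).isSome ↔ (o.β j).isSome},
    fun _ h => h.1, fun _ h => h.2, ?_⟩
  intro (ν₁ : P.Vars → A.Val) (ν₂ : P'.Vars → A.Val) φ hR hp
  have hst := Models.step (P := P) ho (Sum.elim ν₁ φ) hp
  subst hs
  obtain ⟨d', hd', hR'⟩ := h _ _ _ _ _ hR hst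
  obtain ⟨o', ho', h1, h2, h3, h4, h5, h6⟩ := hd'.exists_models hP' F φ
  rw [confState_mkConf] at h1
  rw [confVal_mkConf] at h3 h4 h5 h6
  refine ⟨o', ⟨ho', h1, OpenTransition.isSome_iff_of_holeGraph_eq h4⟩, ?_, h3, h5.symm, ?_⟩
  · intro j b b' hb hb'
    exact OpenTransition.eval_eq_of_holeGraph_eq h4.symm hb hb'
  · change R _ (P'.mkConf o'.tgt (o'.update (Sum.elim ν₂ φ)))
    rw [h2, h6, mkConf_confState_confVal]
    exact hR'

/-- Bisimilarity in terms of configurations. -/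
def ConfBisimilar (P P' : PNet A H) : Prop :=
  ∃ R : P.Conf → P'.Conf → Prop, IsConfSimulation P P' R ∧
    (IsConfSimulation P' P fun d c => R c d) ∧ ∃ c d, P.IsInit c ∧ P'.IsInit d ∧ R c d

/-- Equality of the holes stays a separate condition, since steps see neither the sorts nor the
holes that never act. -/
theorem fhBisimilar_iff {P P' : PNet A H} (hP : P.WellFormed) (hP' : P'.WellFormed) :
    FHBisimilar P P' ↔ P.holes = P'.holes ∧ ConfBisimilar P P' := by
  constructor
  · rintro ⟨R, ⟨hh, h1, h2⟩, ν, ν', hν, hν', hR⟩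
    refine ⟨hh, _, isConfSimulation_of_isFHSimulation hP h1,
      isConfSimulation_of_isFHSimulation hP' h2, _, _, P.isInit_mkConf ν hν,
      P'.isInit_mkConf ν' hν', ?_⟩
    rw [confState_mkConf, confState_mkConf, confVal_mkConf, confVal_mkConf]
    exact hR
  · rintro ⟨hh, R, h1, h2, c, d, hc, hd, hR⟩
    refine ⟨_, ⟨hh, isFHSimulation_of_isConfSimulation hP' h1,
      isFHSimulation_of_isConfSimulation hP h2⟩, P.confVal c, P'.confVal d,
      hc.confVal_eq, hd.confVal_eq, ?_⟩
    rw [← hc.confState_eq, ← hd.confState_eq, mkConf_confState_confVal,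
      mkConf_confState_confVal]
    exact hR

/-! ## Hole actions of steps -/

theorem holeNames_sub_subset {I J : Type u} {sub : I → PNet A H} {name : J → H}
    {sort : J → Set (Sig A)} {K : Type u} {sv : K → SyncVector A I J} (i : I) :
    (sub i).holeNames ⊆ (node I J sub name sort K sv).holeNames :=
  Set.image_mono fun _ hp => Or.inr (Set.mem_iUnion.2 ⟨i, hp⟩)

theorem name_mem_holeNames {I J : Type u} {sub : I → PNet A H} {name : J → H}
    {sort : J → Set (Sig A)} {K : Type u} {sv : K → SyncVector A I J} (j : J) :
    name j ∈ (node I J sub name sort K sv).holeNames :=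
  ⟨(name j, sort j), Or.inl ⟨j, rfl⟩, rfl⟩

theorem Step.mem_holeNames {P : PNet A H} {c c' : P.Conf} {β : Set (H × GroundAction A)}
    {a : GroundAction A} (h : P.Step c β a c') {p : H × GroundAction A} (hp : p ∈ β) :
    p.1 ∈ P.holeNames := by
  induction P generalizing β a with
  | plts L =>
    obtain ⟨t, ht, φ, -, -, rfl, -⟩ := h
    exact hp.elim
  | node I J sub name sort K sv ih =>
    obtain ⟨k, ν, βs, hi, hn, ha, hg, rfl⟩ := h
    rcases hp with ⟨i, hx, hp⟩ | ⟨j, x, -, rfl⟩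
    · obtain ⟨x, hx⟩ := Option.isSome_iff_exists.1 hx
      exact holeNames_sub_subset i (ih i (hi i x hx) hp)
    · exact name_mem_holeNames j

/-- Distinct names leave a single place in the tree from which an action of `h` can come, and there
the vector fixes its value. -/
theorem Step.hole_unique {P : PNet A H} (hP : P.WellFormed) {c c' : P.Conf}
    {β : Set (H × GroundAction A)} {a : GroundAction A} (hs : P.Step c β a c') {h : H}
    {b b' : GroundAction A} (hb : (h, b) ∈ β) (hb' : (h, b') ∈ β) : b = b' := by
  induction P generalizing β a with
  | plts L =>
    obtain ⟨t, ht, φ, -, -, rfl, -⟩ := hs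
    exact hb.elim
  | node I J sub name sort K sv ih =>
    obtain ⟨k, ν, βs, hi, hn, ha, hg, rfl⟩ := hs
    obtain ⟨-, hinj, hd, hdd, -, -, -, hwf⟩ := hP
    have hname : ∀ i b, ((sv k).act (Sum.inl i)).isSome → (h, b) ∈ βs i →
        h ∈ (sub i).holeNames := by
      intro i b hx hp
      obtain ⟨x, hx⟩ := Option.isSome_iff_exists.1 hx
      exact (hi i x hx).mem_holeNames hp
    rcases hb with ⟨i, hx, hp⟩ | ⟨j, x, hx, e⟩ <;>
      rcases hb' with ⟨i', hx', hp'⟩ | ⟨j', x', hx', e'⟩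
    · have : i = i' := by
        by_contra hne
        exact Set.disjoint_left.1 (hdd i i' hne) (hname _ _ hx hp) (hname _ _ hx' hp')
      subst this
      obtain ⟨x, hx⟩ := Option.isSome_iff_exists.1 hx
      exact ih i (hwf i) (hi i x hx) hp hp'
    · cases e'
      exact (Set.disjoint_left.1 (hd i) (hname _ _ hx hp) ⟨j', rfl⟩).elim
    · cases e
      exact (Set.disjoint_left.1 (hd i') (hname _ _ hx' hp') ⟨j, rfl⟩).elim
    · rw [Prod.mk.injEq] at e e'
      have : j = j' := hinj (e.1.symm.trans e'.1)
      subst this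
      rw [hx, Option.some.injEq] at hx'
      rw [e.2, e'.2, hx']

/-! ## Filling -/

theorem sorts_fill (B : Set H) (Q : H → PNet A H) (P : PNet A H) :
    (P.fill B Q).sorts = P.sorts := by
  cases P <;> rfl

theorem holes_fill (B : Set H) (Q : H → PNet A H) (P : PNet A H) :
    (P.fill B Q).holes =
      {p | p ∈ P.holes ∧ p.1 ∉ B} ∪ {p | ∃ h ∈ B, h ∈ P.holeNames ∧ p ∈ (Q h).holes} := by
  induction P with
  | plts L => ext p; simp [fill, holes, holeNames]
  | node I J sub name sort K sv ih =>
    ext p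
    constructor
    · rintro (⟨j, rfl⟩ | hp)
      · exact Or.inl ⟨Or.inl ⟨j.1, rfl⟩, j.2⟩
      · obtain ⟨i | j, hp⟩ := Set.mem_iUnion.1 hp
        · change p ∈ ((sub i).fill B Q).holes at hp
          rw [ih i] at hp
          rcases hp with ⟨hp, hB⟩ | ⟨h, hB, hh, hp⟩
          · exact Or.inl ⟨Or.inr (Set.mem_iUnion.2 ⟨i, hp⟩), hB⟩
          · exact Or.inr ⟨h, hB, holeNames_sub_subset i hh, hp⟩
        · exact Or.inr ⟨name j.1, j.2, name_mem_holeNames j.1, hp⟩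
    · rintro (⟨⟨j, rfl⟩ | hp, hB⟩ | ⟨h, hB, ⟨q, ⟨j, rfl⟩ | hq, rfl⟩, hp⟩)
      · exact Or.inl ⟨⟨j, hB⟩, rfl⟩
      · obtain ⟨i, hp⟩ := Set.mem_iUnion.1 hp
        refine Or.inr (Set.mem_iUnion.2 ⟨Sum.inl i, ?_⟩)
        change p ∈ ((sub i).fill B Q).holes
        rw [ih i]
        exact Or.inl ⟨hp, hB⟩
      · exact Or.inr (Set.mem_iUnion.2 ⟨Sum.inr ⟨j, hB⟩, hp⟩)
      · obtain ⟨i, hq⟩ := Set.mem_iUnion.1 hq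
        refine Or.inr (Set.mem_iUnion.2 ⟨Sum.inl i, ?_⟩)
        change p ∈ ((sub i).fill B Q).holes
        rw [ih i]
        exact Or.inr ⟨q.1, hB, ⟨q, hq, rfl⟩, hp⟩

theorem mem_holeNames_fill {B : Set H} {Q : H → PNet A H} {P : PNet A H} {x : H}
    (hx : x ∈ (P.fill B Q).holeNames) :
    (x ∈ P.holeNames ∧ x ∉ B) ∨ ∃ h ∈ B, h ∈ P.holeNames ∧ x ∈ (Q h).holeNames := by
  obtain ⟨p, hp, rfl⟩ := hx
  rw [holes_fill] at hp
  rcases hp with ⟨hp, hB⟩ | ⟨h, hB, hh, hp⟩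
  · exact Or.inl ⟨⟨p, hp, rfl⟩, hB⟩
  · exact Or.inr ⟨h, hB, hh, p, hp, rfl⟩

/-- A clash of names in the filled pNet would be between two holes of `P`, between a remaining hole
and a hole of a filling, or between holes of two fillings; each is excluded. Vectors stay well
sorted because filling preserves the sorts of sub-pNets and each filling has the sort of its hole.
-/
theorem WellFormed.fill {P : PNet A H} (hP : P.WellFormed) {B : Set H} {Q : H → PNet A H}
    (hQ : ∀ j ∈ B, (Q j).WellFormed)
    (hsort : ∀ j ∈ B, ∀ τ, (j, τ) ∈ P.holes → (Q j).sorts = τ)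
    (hrest : ∀ j ∈ B, Disjoint (Q j).holeNames (P.holeNames \ B))
    (hdisj : ∀ j ∈ B, ∀ j' ∈ B, j ≠ j' → Disjoint (Q j).holeNames (Q j').holeNames) :
    (P.fill B Q).WellFormed := by
  induction P with
  | plts L => trivial
  | node I J sub name sort K sv ih =>
    obtain ⟨hne, hinj, hd, hdd, hsub, hhole, hvars, hwf⟩ := hP
    have hrest' : ∀ j ∈ B, ∀ x, x ∈ (Q j).holeNames →
        x ∈ (node I J sub name sort K sv).holeNames → x ∉ B → False :=
      fun j hj x hx hx' hB => Set.disjoint_left.1 (hrest j hj) hx ⟨hx', hB⟩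
    have hdisj' : ∀ j ∈ B, ∀ j' ∈ B, j ≠ j' → ∀ x, x ∈ (Q j).holeNames →
        x ∈ (Q j').holeNames → False :=
      fun j hj j' hj' e x hx hx' => Set.disjoint_left.1 (hdisj j hj j' hj' e) hx hx'
    -- A hole filled inside `sub i` and a hole filled at this node bear different names, so `hdisj'`
    -- applies to their fillings.
    have hSQ : ∀ i (j : {j : J // name j ∈ B}) x, x ∈ ((sub i).fill B Q).holeNames →
        x ∈ (Q (name j.1)).holeNames → False := by
      intro i j x hx hx'
      rcases mem_holeNames_fill hx with ⟨h1, h2⟩ | ⟨h, h1, h2, h3⟩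
      · exact hrest' _ j.2 x hx' (holeNames_sub_subset i h1) h2
      · refine hdisj' h h1 _ j.2 ?_ x h3 hx'
        rintro rfl
        exact Set.disjoint_left.1 (hd i) h2 ⟨j.1, rfl⟩
    refine ⟨?_, fun j j' e => Subtype.ext (hinj e), ?_, ?_, ?_, ?_, ?_, ?_⟩
    · rcases hne with ⟨i | j⟩
      · exact ⟨Sum.inl (Sum.inl i)⟩
      · by_cases hj : name j ∈ B
        · exact ⟨Sum.inl (Sum.inr ⟨j, hj⟩)⟩
        · exact ⟨Sum.inr ⟨j, hj⟩⟩
    · rintro (i | j) <;> refine Set.disjoint_left.2 ?_ <;> rintro x hx ⟨j', rfl⟩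
      · rcases mem_holeNames_fill hx with ⟨h1, -⟩ | ⟨h, h1, h2, h3⟩
        · exact Set.disjoint_left.1 (hd i) h1 ⟨j'.1, rfl⟩
        · exact hrest' h h1 _ h3 (name_mem_holeNames j'.1) j'.2
      · exact hrest' _ j.2 _ hx (name_mem_holeNames j'.1) j'.2
    · rintro (i | j) (i' | j') e <;> refine Set.disjoint_left.2 fun x hx hx' => ?_
      · have e' : i ≠ i' := fun e' => e (congrArg Sum.inl e')
        rcases mem_holeNames_fill hx with ⟨h1, h2⟩ | ⟨h, h1, h2, h3⟩ <;>
          rcases mem_holeNames_fill hx' with ⟨g1, g2⟩ | ⟨g, g1, g2, g3⟩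
        · exact Set.disjoint_left.1 (hdd i i' e') h1 g1
        · exact hrest' g g1 x g3 (holeNames_sub_subset i h1) h2
        · exact hrest' h h1 x h3 (holeNames_sub_subset i' g1) g2
        · refine hdisj' h h1 g g1 ?_ x h3 g3
          rintro rfl
          exact Set.disjoint_left.1 (hdd i i' e') h2 g2
      · exact hSQ i j' x hx hx'
      · exact hSQ i' j x hx' hx
      · exact hdisj' _ j.2 _ j'.2 (fun h => e (congrArg Sum.inr (Subtype.ext (hinj h)))) x hx hx'
    · rintro k (i | j) a ha
      · change a.sig ∈ ((sub i).fill B Q).sorts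
        rw [sorts_fill]
        exact hsub k i a ha
      · change a.sig ∈ (Q (name j.1)).sorts
        rw [hsort _ j.2 (sort j.1) (Or.inl ⟨j.1, rfl⟩)]
        exact hhole k j.1 a ha
    · exact fun k j a ha => hhole k j.1 a ha
    · intro k x hx
      obtain ⟨l, a, ha, hxa⟩ := hvars k hx
      rcases l with i | j
      · exact ⟨Sum.inl (Sum.inl i), a, ha, hxa⟩
      · by_cases hj : name j ∈ B
        · exact ⟨Sum.inl (Sum.inr ⟨j, hj⟩), a, ha, hxa⟩
        · exact ⟨Sum.inr ⟨j, hj⟩, a, ha, hxa⟩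
    · rintro (i | j)
      · refine ih i (hwf i) (fun j hj τ hτ => hsort j hj τ (Or.inr (Set.mem_iUnion.2 ⟨i, hτ⟩)))
          fun j hj => (hrest j hj).mono_right ?_
        exact Set.sdiff_subset_sdiff_left (holeNames_sub_subset i)
      · exact hQ _ j.2

/-! ### Composing and decomposing steps of a filled pNet -/

section FillConf

variable {B : Set H} {Q : H → PNet A H}

/-- The configuration of a filled pNet, from one of the pNet and those of the pNets that fill the
holes. -/
def fillConf (q : ∀ h : B, (Q h).Conf) : (P : PNet A H) → P.Conf → (P.fill B Q).Conf
  | plts _, c => c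
  | node _ _ sub name _ _ _, c =>
      Sum.rec (fun i => (sub i).fillConf q (c i)) (fun j => q ⟨name j.1, j.2⟩)

/-- Fillings of names that are not holes of `P` play no role; this lets a global family `q` be
replaced by one correct only on a subtree. -/
theorem fillConf_congr {q q' : ∀ h : B, (Q h).Conf} (P : PNet A H) (c : P.Conf)
    (h : ∀ x : B, (x : H) ∈ P.holeNames → q x = q' x) :
    P.fillConf q c = P.fillConf q' c := by
  induction P with
  | plts L => rfl
  | node I J sub name sort K sv ih =>
    funext l
    rcases l with i | j
    · exact ih i (c i) fun x hx => h x (holeNames_sub_subset i hx)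
    · exact h ⟨name j.1, j.2⟩ (name_mem_holeNames j.1)

theorem IsInit.fillConf {q : ∀ h : B, (Q h).Conf} (hq : ∀ h : B, (Q h).IsInit (q h))
    {P : PNet A H} {c : P.Conf} (hc : P.IsInit c) : (P.fill B Q).IsInit (P.fillConf q c) := by
  induction P with
  | plts L => exact hc
  | node I J sub name sort K sv ih =>
    rintro (i | j)
    · exact ih i (hc i)
    · exact hq ⟨name j.1, j.2⟩

/-- The hole actions of a filled pNet, from those of the pNet and those of the pNets that fill
the holes. -/
def fillActions (β : Set (H × GroundAction A)) (γ : B → Set (H × GroundAction A)) :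
    Set (H × GroundAction A) :=
  {p | (p ∈ β ∧ p.1 ∉ B) ∨ ∃ (h : B) (b : GroundAction A), ((h : H), b) ∈ β ∧ p ∈ γ h}

/-- The same vector under the same valuation fires: where a hole performed `b`, its filling now
performs a step with global action `b`. -/
theorem Step.fill {P : PNet A H} (hP : P.WellFormed) {c c' : P.Conf}
    {β : Set (H × GroundAction A)} {a : GroundAction A} (hs : P.Step c β a c')
    {q q' : ∀ h : B, (Q h).Conf} {γ : B → Set (H × GroundAction A)}
    (hq : ∀ (h : B) (b : GroundAction A), ((h : H), b) ∈ β → (Q h).Step (q h) (γ h) b (q' h))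
    (hq' : ∀ h : B, (h : H) ∈ P.holeNames → (∀ b, ((h : H), b) ∉ β) → q' h = q h) :
    (P.fill B Q).Step (P.fillConf q c) (fillActions β γ) a (P.fillConf q' c') := by
  induction P generalizing β a with
  | plts L =>
    obtain ⟨t, ht, φ, h1, h2, rfl, h3, h4, h5⟩ := hs
    refine ⟨t, ht, φ, h1, h2, ?_, h3, h4, h5⟩
    ext p; simp [fillActions]
  | node I J sub name sort K sv ih =>
    obtain ⟨k, ν, βs, hi, hn, ha, hg, rfl⟩ := hs
    obtain ⟨-, hinj, hd, hdd, -, -, -, hwf⟩ := hP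
    have hname : ∀ i h b, ((sv k).act (Sum.inl i)).isSome → (h, b) ∈ βs i →
        h ∈ (sub i).holeNames := by
      intro i h b hx hp
      obtain ⟨x, hx⟩ := Option.isSome_iff_exists.1 hx
      exact (hi i x hx).mem_holeNames hp
    -- A hole inside `sub i` that is silent there is silent in the whole step, as its name occurs
    -- nowhere else.
    have hnot : ∀ i (h : B), (h : H) ∈ (sub i).holeNames →
        (((sv k).act (Sum.inl i)).isSome → ∀ b, ((h : H), b) ∉ βs i) → q' h = q h := by
      intro i h hh hb
      refine hq' h (holeNames_sub_subset i hh) fun b => ?_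
      rintro (⟨i', hx, hp⟩ | ⟨j, x, hx, e⟩)
      · have : i = i' := by
          by_contra hne
          exact Set.disjoint_left.1 (hdd i i' hne) hh (hname i' _ _ hx hp)
        subst this
        exact hb hx b hp
      · rw [Prod.mk.injEq] at e
        exact Set.disjoint_left.1 (hd i) hh ⟨j, e.1.symm⟩
    refine ⟨k, ν, Sum.elim (fun i => fillActions (βs i) γ) (fun j => γ ⟨name j.1, j.2⟩),
      ?_, ?_, ha, hg, ?_⟩
    · rintro (i | j) x hx
      · have hx' : ((sv k).act (Sum.inl i)).isSome := Option.isSome_iff_exists.2 ⟨x, hx⟩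
        exact ih i (hwf i) (hi i x hx) (fun h b hb => hq h b (Or.inl ⟨i, hx', hb⟩))
          fun h hh hb => hnot i h hh fun _ => hb
      · exact hq ⟨name j.1, j.2⟩ _ (Or.inr ⟨j.1, x, hx, rfl⟩)
    · rintro (i | j) hx
      · have hx' : (sv k).act (Sum.inl i) = none := hx
        change (sub i).fillConf q' (c' i) = (sub i).fillConf q (c i)
        rw [hn i hx']
        exact fillConf_congr _ _ fun h hh => hnot i h hh fun e => by simp [hx'] at e
      · have hx' : (sv k).act (Sum.inr j.1) = none := hx
        refine hq' ⟨name j.1, j.2⟩ (name_mem_holeNames j.1) fun b => ?_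
        rintro (⟨i, hi', hp⟩ | ⟨j', x, hj', e⟩)
        · exact Set.disjoint_left.1 (hd i) (hname i _ _ hi' hp) ⟨j.1, rfl⟩
        · rw [Prod.mk.injEq] at e
          rw [← hinj e.1, hx'] at hj'
          cases hj'
    · ext p
      constructor
      · rintro (⟨⟨i, hx, hp⟩ | ⟨j, x, hx, rfl⟩, hB⟩ | ⟨h, b, ⟨i, hx, hb⟩ | ⟨j, x, hx, e⟩, hp⟩)
        · exact Or.inl ⟨Sum.inl i, hx, Or.inl ⟨hp, hB⟩⟩
        · exact Or.inr ⟨⟨j, hB⟩, x, hx, rfl⟩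
        · exact Or.inl ⟨Sum.inl i, hx, Or.inr ⟨h, b, hb, hp⟩⟩
        · rw [Prod.mk.injEq] at e
          obtain ⟨h, hB⟩ := h
          obtain ⟨rfl, -⟩ := e
          exact Or.inl ⟨Sum.inr ⟨j, hB⟩, Option.isSome_iff_exists.2 ⟨x, hx⟩, hp⟩
      · rintro (⟨i | j, hx, hp⟩ | ⟨j, x, hx, rfl⟩)
        · rcases hp with ⟨hp, hB⟩ | ⟨h, b, hb, hp⟩
          · exact Or.inl ⟨Or.inl ⟨i, hx, hp⟩, hB⟩
          · exact Or.inr ⟨h, b, Or.inl ⟨i, hx, hb⟩, hp⟩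
        · obtain ⟨x, hx⟩ := Option.isSome_iff_exists.1 hx
          exact Or.inr ⟨⟨name j.1, j.2⟩, x.eval ν, Or.inr ⟨j.1, x, hx, rfl⟩, hp⟩
        · exact Or.inl ⟨Or.inr ⟨j.1, x, hx, rfl⟩, j.2⟩

/-- Converse of `Step.fill`: read the hole actions of `P` off the firing vectors. Each sub-pNet
yields its own families of target configurations and actions for all of `B`; they are glued using
the distinctness of names. -/
theorem Step.exists_of_fill {P : PNet A H} (hP : P.WellFormed) {c : P.Conf}
    {q : ∀ h : B, (Q h).Conf} {δ : Set (H × GroundAction A)} {a : GroundAction A}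
    {d : (P.fill B Q).Conf} (hs : (P.fill B Q).Step (P.fillConf q c) δ a d) :
    ∃ (β : Set (H × GroundAction A)) (c' : P.Conf) (q' : ∀ h : B, (Q h).Conf)
      (γ : B → Set (H × GroundAction A)), d = P.fillConf q' c' ∧ P.Step c β a c' ∧
      (∀ (h : B) (b : GroundAction A), ((h : H), b) ∈ β → (Q h).Step (q h) (γ h) b (q' h)) ∧
      (∀ h : B, (∀ b, ((h : H), b) ∉ β) → q' h = q h) ∧ δ = fillActions β γ := by
  induction P generalizing δ a with
  | plts L =>
    obtain ⟨t, ht, φ, h1, h2, rfl, h3, h4, h5⟩ := hs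
    refine ⟨∅, d, q, fun _ => ∅, rfl, ⟨t, ht, φ, h1, h2, rfl, h3, h4, h5⟩,
      fun h b hb => False.elim hb, fun _ _ => rfl, ?_⟩
    ext p; simp [fillActions]
  | node I J sub name sort K sv ih =>
    obtain ⟨k, ν, βs, hi, hn, ha, hg, rfl⟩ := hs
    obtain ⟨-, hinj, hd, hdd, -, -, -, hwf⟩ := hP
    -- Idle sub-pNets are given empty hole actions and unchanged fillings, so that the choice below
    -- covers all `i` uniformly.
    have H1 : ∀ i, ∃ (β : Set (H × GroundAction A)) (c' : (sub i).Conf)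
        (q' : ∀ h : B, (Q h).Conf) (γ : B → Set (H × GroundAction A)),
        d (Sum.inl i) = (sub i).fillConf q' c' ∧
        (∀ x, (sv k).act (Sum.inl i) = some x → (sub i).Step (c i) β (x.eval ν) c') ∧
        ((sv k).act (Sum.inl i) = none → c' = c i ∧ β = ∅) ∧
        (∀ (h : B) (b : GroundAction A), ((h : H), b) ∈ β →
          (Q h).Step (q h) (γ h) b (q' h)) ∧
        (∀ h : B, (∀ b, ((h : H), b) ∉ β) → q' h = q h) ∧
        (((sv k).act (Sum.inl i)).isSome → βs (Sum.inl i) = fillActions β γ) := by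
      intro i
      cases hx : (sv k).act (Sum.inl i) with
      | none =>
        exact ⟨∅, c i, q, fun _ => ∅, hn (Sum.inl i) hx, fun x e => (nomatch e),
          fun _ => ⟨rfl, rfl⟩, fun h b hb => False.elim hb, fun _ _ => rfl,
          fun e => (nomatch e)⟩
      | some x =>
        obtain ⟨β, c', q', γ, h1, h2, h3, h4, h5⟩ := ih i (hwf i) (hi (Sum.inl i) x hx)
        exact ⟨β, c', q', γ, h1, fun y e => by cases e; exact h2, fun e => (nomatch e), h3, h4,
          fun _ => h5⟩
    choose β c' r γ hd' hstep hnone hr hr' hβ using H1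
    have hname : ∀ i h b, (h, b) ∈ β i → h ∈ (sub i).holeNames := by
      intro i h b hp
      cases hx : (sv k).act (Sum.inl i) with
      | none => rw [(hnone i hx).2] at hp; exact hp.elim
      | some x => exact (hstep i x hx).mem_holeNames hp
    -- Gluing according to where `h` sits: inside one sub-pNet, at this node, or nowhere. The `HEq`
    -- arises because `d (Sum.inr j)` is typed over `name j.1`, only propositionally equal to `h`.
    have H2 : ∀ h : B, ∃ (q' : (Q h).Conf) (γ' : Set (H × GroundAction A)),
        (∀ i, (h : H) ∈ (sub i).holeNames → q' = r i h ∧ γ' = γ i h) ∧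
        (∀ j : {j : J // name j ∈ B}, name j.1 = h →
          HEq (d (Sum.inr j)) q' ∧ γ' = βs (Sum.inr j)) ∧
        ((∀ i, (h : H) ∉ (sub i).holeNames) → (∀ j, name j ≠ h) → q' = q h) := by
      rintro ⟨h, hB⟩
      by_cases h1 : ∃ i, h ∈ (sub i).holeNames
      · obtain ⟨i, h1⟩ := h1
        refine ⟨r i ⟨h, hB⟩, γ i ⟨h, hB⟩, ?_, ?_, fun e => (e i h1).elim⟩
        · intro i' h2
          have : i = i' := by
            by_contra hne
            exact Set.disjoint_left.1 (hdd i i' hne) h1 h2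
          subst this
          exact ⟨rfl, rfl⟩
        · intro j e
          exact (Set.disjoint_left.1 (hd i) h1 ⟨j.1, e⟩).elim
      · by_cases h2 : ∃ j, name j = h
        · obtain ⟨j, rfl⟩ := h2
          refine ⟨d (Sum.inr ⟨j, hB⟩), βs (Sum.inr ⟨j, hB⟩), fun i e => (h1 ⟨i, e⟩).elim, ?_,
            fun _ e => (e j rfl).elim⟩
          rintro ⟨j', hj'⟩ e
          have : j' = j := hinj e
          subst this
          exact ⟨HEq.rfl, rfl⟩
        · exact ⟨q ⟨h, hB⟩, ∅, fun i e => (h1 ⟨i, e⟩).elim, fun j e => (h2 ⟨j.1, e⟩).elim,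
            fun _ _ => rfl⟩
    choose q' γ' hsub hfill hother using H2
    refine ⟨{p | (∃ i, ((sv k).act (Sum.inl i)).isSome ∧ p ∈ β i) ∨
      ∃ j x, (sv k).act (Sum.inr j) = some x ∧ p = (name j, x.eval ν)}, c', q', γ', ?_,
      ⟨k, ν, β, hstep, fun i hx => (hnone i hx).1, ha, hg, rfl⟩, ?_, ?_, ?_⟩
    · funext l
      rcases l with i | j
      · rw [hd' i]
        exact fillConf_congr _ _ fun h hh => ((hsub h i hh).1).symm
      · exact eq_of_heq (hfill ⟨name j.1, j.2⟩ j rfl).1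
    · rintro h b (⟨i, -, hb⟩ | ⟨j, x, hx, e⟩)
      · obtain ⟨e1, e2⟩ := hsub h i (hname i _ _ hb)
        rw [e1, e2]
        exact hr i h b hb
      · obtain ⟨h, hB⟩ := h
        rw [Prod.mk.injEq] at e
        obtain ⟨rfl, rfl⟩ := e
        obtain ⟨e1, e2⟩ := hfill ⟨name j, hB⟩ ⟨j, hB⟩ rfl
        rw [e2, ← eq_of_heq e1]
        exact hi (Sum.inr ⟨j, hB⟩) x hx
    · intro h hb
      by_cases h1 : ∃ i, (h : H) ∈ (sub i).holeNames
      · obtain ⟨i, h1⟩ := h1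
        rw [(hsub h i h1).1]
        refine hr' i h fun b hb' => ?_
        cases hx : (sv k).act (Sum.inl i) with
        | none => rw [(hnone i hx).2] at hb'; exact hb'
        | some x => exact hb b (Or.inl ⟨i, by rw [hx]; rfl, hb'⟩)
      · by_cases h2 : ∃ j, name j = h
        · obtain ⟨h, hB⟩ := h
          obtain ⟨j, rfl⟩ := h2
          rw [← eq_of_heq (hfill ⟨name j, hB⟩ ⟨j, hB⟩ rfl).1]
          refine hn (Sum.inr ⟨j, hB⟩) ?_
          cases hx : (sv k).act (Sum.inr j) with
          | none => exact hx
          | some x => exact (hb _ (Or.inr ⟨j, x, hx, rfl⟩)).elim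
        · exact hother h (fun i e => h1 ⟨i, e⟩) fun j e => h2 ⟨j, e⟩
    · ext p
      constructor
      · rintro (⟨i | j, hx, hp⟩ | ⟨j, x, hx, rfl⟩)
        · rw [hβ i hx] at hp
          rcases hp with ⟨hp, hB⟩ | ⟨h, b, hb, hp⟩
          · exact Or.inl ⟨Or.inl ⟨i, hx, hp⟩, hB⟩
          · refine Or.inr ⟨h, b, Or.inl ⟨i, hx, hb⟩, ?_⟩
            rwa [(hsub h i (hname i _ _ hb)).2]
        · obtain ⟨x, hx⟩ := Option.isSome_iff_exists.1 hx
          refine Or.inr ⟨⟨name j.1, j.2⟩, x.eval ν, Or.inr ⟨j.1, x, hx, rfl⟩, ?_⟩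
          rwa [(hfill ⟨name j.1, j.2⟩ j rfl).2]
        · exact Or.inl ⟨Or.inr ⟨j.1, x, hx, rfl⟩, j.2⟩
      · rintro (⟨⟨i, hx, hp⟩ | ⟨j, x, hx, rfl⟩, hB⟩ | ⟨h, b, ⟨i, hx, hb⟩ | ⟨j, x, hx, e⟩, hp⟩)
        · refine Or.inl ⟨Sum.inl i, hx, ?_⟩
          rw [hβ i hx]
          exact Or.inl ⟨hp, hB⟩
        · exact Or.inr ⟨⟨j, hB⟩, x, hx, rfl⟩
        · refine Or.inl ⟨Sum.inl i, hx, ?_⟩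
          rw [hβ i hx]
          refine Or.inr ⟨h, b, hb, ?_⟩
          rwa [(hsub h i (hname i _ _ hb)).2] at hp
        · obtain ⟨h, hB⟩ := h
          rw [Prod.mk.injEq] at e
          obtain ⟨rfl, -⟩ := e
          refine Or.inl ⟨Sum.inr ⟨j, hB⟩, Option.isSome_iff_exists.2 ⟨x, hx⟩, ?_⟩
          rwa [(hfill ⟨name j, hB⟩ ⟨j, hB⟩ rfl).2] at hp

/-- The relation between the configurations of two filled pNets that is induced by relations
between the pNets and between those that fill the holes. -/
def fillRel {P P' : PNet A H} {Q' : H → PNet A H} (R : P.Conf → P'.Conf → Prop)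
    (T : ∀ h : B, (Q h).Conf → (Q' h).Conf → Prop) (c : (P.fill B Q).Conf)
    (d : (P'.fill B Q').Conf) : Prop :=
  ∃ c₀ q d₀ q', c = P.fillConf q c₀ ∧ d = P'.fillConf q' d₀ ∧ R c₀ d₀ ∧ ∀ h, T h (q h) (q' h)

/-- The answer in `P'` has the same hole actions `β`, so exactly the same holes must be animated,
with the same values; the answers of the `Q' h` then fit it. -/
theorem IsConfSimulation.fill {P P' : PNet A H} (hP : P.WellFormed) (hP' : P'.WellFormed)
    {Q' : H → PNet A H} {R : P.Conf → P'.Conf → Prop}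
    {T : ∀ h : B, (Q h).Conf → (Q' h).Conf → Prop} (hR : IsConfSimulation P P' R)
    (hT : ∀ h : B, IsConfSimulation (Q h) (Q' h) (T h)) :
    IsConfSimulation (P.fill B Q) (P'.fill B Q') (fillRel R T) := by
  rintro _ _ δ a c₁ ⟨c, q, d, q', rfl, rfl, hcd, hq⟩ hs
  obtain ⟨β, c', r, γ, rfl, hc, h1, h2, rfl⟩ := hs.exists_of_fill hP
  obtain ⟨d', hd, hcd'⟩ := hR c d β a c' hcd hc
  have H : ∀ h : B, ∃ r' : (Q' h).Conf, T h (r h) r' ∧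
      (∀ b, ((h : H), b) ∈ β → (Q' h).Step (q' h) (γ h) b r') ∧
      ((∀ b, ((h : H), b) ∉ β) → r' = q' h) := by
    intro h
    by_cases hb : ∃ b, ((h : H), b) ∈ β
    · obtain ⟨b, hb⟩ := hb
      obtain ⟨r', h3, h4⟩ := hT h _ _ _ _ _ (hq h) (h1 h b hb)
      -- `r'` answers the step for one `b`; uniqueness of the action of `h` makes it serve for every
      -- `b'`.
      exact ⟨r', h4, fun b' hb' => hc.hole_unique hP hb hb' ▸ h3, fun e => (e b hb).elim⟩
    · refine ⟨q' h, ?_, fun b e => (hb ⟨b, e⟩).elim, fun _ => rfl⟩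
      rw [h2 h fun b e => hb ⟨b, e⟩]
      exact hq h
  choose r' h3 h4 h5 using H
  exact ⟨_, hd.fill hP' h4 fun h _ => h5 h, c', r, d', r', rfl, rfl, hcd', h3⟩

theorem ConfBisimilar.fill {P P' : PNet A H} (hP : P.WellFormed) (hP' : P'.WellFormed)
    {Q' : H → PNet A H} (h : ConfBisimilar P P')
    (hQ : ∀ h : B, ConfBisimilar (Q h) (Q' h)) :
    ConfBisimilar (P.fill B Q) (P'.fill B Q') := by
  obtain ⟨R, h1, h2, c, d, hc, hd, hR⟩ := h
  choose T h3 h4 q q' hq hq' hT using hQ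
  refine ⟨fillRel R T, h1.fill hP hP' h3, ?_, P.fillConf q c, P'.fillConf q' d,
    hc.fillConf hq, hd.fillConf hq', c, q, d, q', rfl, rfl, hR, hT⟩
  have := h2.fill hP' hP (T := fun h y x => T h x y) h4
  -- The converse of `fillRel R T` is `fillRel` of the converse relations.
  convert this using 3
  exact ⟨fun ⟨c, q, d, q', e1, e2, e3, e4⟩ => ⟨d, q', c, q, e2, e1, e3, e4⟩,
    fun ⟨d, q', c, q, e2, e1, e3, e4⟩ => ⟨c, q, d, q', e1, e2, e3, e4⟩⟩

end FillConf

theorem holes_fill_congr {P P' : PNet A H} {B : Set H} {Q Q' : H → PNet A H}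
    (h : P.holes = P'.holes) (hQ : ∀ j ∈ B, (Q j).holes = (Q' j).holes) :
    (P.fill B Q).holes = (P'.fill B Q').holes := by
  ext p
  simp only [holes_fill, holeNames, h, Set.mem_union, Set.mem_ofPred_eq]
  refine or_congr Iff.rfl (exists_congr fun j => and_congr_right fun hj => ?_)
  rw [hQ j hj]

end PNet

theorem mainTheorem3 {A : TermAlgebra.{u}} {H : Type u} (P P' : PNet A H)
    (hP : P.WellFormed) (hP' : P'.WellFormed) (hPP' : FHBisimilar P P')
    -- a subset of the holes, and the pNets that fill them
    (B : Set H) (hB : B ⊆ P.holeNames) (Q Q' : H → PNet A H)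
    (hQ : ∀ j ∈ B, (Q j).WellFormed) (hQ' : ∀ j ∈ B, (Q' j).WellFormed)
    (hQQ' : ∀ j ∈ B, FHBisimilar (Q j) (Q' j))
    -- the filling pNets have the sorts of the holes
    (hsort : ∀ j ∈ B, ∀ τ, (j, τ) ∈ P.holes → (Q j).sorts = τ ∧ (Q' j).sorts = τ)
    -- the holes of the filling pNets clash neither with each other nor with the remaining holes
    (hrest : ∀ j ∈ B, Disjoint (Q j).holeNames (P.holeNames \ B))
    (hdisj : ∀ j ∈ B, ∀ j' ∈ B, j ≠ j' → Disjoint (Q j).holeNames (Q j').holeNames) :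
    (P.fill B Q).WellFormed ∧ (P'.fill B Q').WellFormed ∧
      FHBisimilar (P.fill B Q) (P'.fill B Q') := by
  have hb := (PNet.fhBisimilar_iff hP hP').1 hPP'
  have hbQ : ∀ j ∈ B, (Q j).holes = (Q' j).holes ∧ PNet.ConfBisimilar (Q j) (Q' j) :=
    fun j hj => (PNet.fhBisimilar_iff (hQ j hj) (hQ' j hj)).1 (hQQ' j hj)
  have hn : P.holeNames = P'.holeNames := congrArg (Set.image Prod.fst) hb.1
  have hnQ : ∀ j ∈ B, (Q j).holeNames = (Q' j).holeNames :=
    fun j hj => congrArg (Set.image Prod.fst) (hbQ j hj).1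
  have hF : (P.fill B Q).WellFormed :=
    hP.fill hQ (fun j hj τ hτ => (hsort j hj τ hτ).1) hrest hdisj
  have hF' : (P'.fill B Q').WellFormed := by
    -- The hypotheses on names concern `P` and `Q`; they transfer because bisimilar pNets have the
    -- same holes.
    refine hP'.fill hQ' (fun j hj τ hτ => (hsort j hj τ (hb.1 ▸ hτ)).2) ?_ ?_
    · intro j hj
      rw [← hn, ← hnQ j hj]
      exact hrest j hj
    · intro j hj j' hj' e
      rw [← hnQ j hj, ← hnQ j' hj']
      exact hdisj j hj j' hj' e
  exact ⟨hF, hF', (PNet.fhBisimilar_iff hF hF').2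
    ⟨PNet.holes_fill_congr hb.1 fun j hj => (hbQ j hj).1,
      hb.2.fill hP hP' fun j => (hbQ j j.2).2⟩⟩
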